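/- Proposition. Let $\Gamma$ be a connected core graph, that is, a connected finite $1$-dimensional CW complex all of whose vertices have valence at least $2$ (valence counts ends of edges, so a loop at $v$ counts twice). Let $f:\Gamma\to\Gamma$ be an immersion, i.e. a continuous locally injective map. Assume that all vertices of $\Gamma$ have valence at least $3$ or, more generally, that $f$ maps vertices to vertices (in the first case this is automatic). For $i\ge 0$ let $\Gamma_i=\{(x,y)\in\Gamma\times\Gamma : f^i(x)=f^i(y)\}$, the pullback of $f^i$ with itself ($\Gamma_0$ is the diagonal). For $i\ge 1$ let $\hat\Gamma_i$ be the maximal core subgraph of $\Gamma_i\setminus\Gamma_{i-1}$, i.e. the union of all subspaces of $\Gamma_i\setminus\Gamma_{i-1}$ that are finite graphs with all vertices of valence at least $2$ (so contractible components of $\Gamma_i\setminus\Gamma_{i-1}$ contribute nothing). If $\hat\Gamma_i$ is nonempty for every $i\ge 1$, then $f$ has an invariant loop of degree $d$ for some $d\ge 2$: there are integers $k\ge 1$ and $d\ge 2$ and a loop $\sigma:\mathbb R/\mathbb Z\to\Gamma$, not homotopic to a constant map, such that $f^k\circ\sigma$ is freely homotopic to $\sigma^d$, where $\sigma^d(t)=\sigma(dt)$.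 -/

import Mathlib

namespace GraphImmersion

open Set Metric Topology

universe u

section Graphs

variable {X : Type u} [TopologicalSpace X]

/-- A finite graph: the subspace `C` with its given CW structure is a finite CW complex without
cells of dimension at least two. -/
structure IsFiniteGraph (C : Set X) [CWComplex C] : Prop where
  finite : CWComplex.Finite C
  dim_le_one : ∀ n, 2 ≤ n → IsEmpty (RelCWComplex.cell C n)

/-- The vertex of `C` (a point of the ambient space) given by a `0`-cell. -/
def vertex (C : Set X) [CWComplex C] (v : RelCWComplex.cell C 0) : X :=
  RelCWComplex.map 0 v ![]

/-- The set of vertices of `C`. -/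
def vertexSet (C : Set X) [CWComplex C] : Set X := range (vertex C)

/-- The valence of a vertex `v`: the number of ends of edges attached to `v`, where an end of an
edge `e` is one of the two points of the sphere `{-1, 1}` bounding its parameter interval.
An edge that is a loop at `v` is counted twice. -/
noncomputable def valence (C : Set X) [CWComplex C] (v : RelCWComplex.cell C 0) : ℕ∞ :=
  {h : RelCWComplex.cell C 1 × sphere (0 : Fin 1 → ℝ) 1 |
    RelCWComplex.map 1 h.1 (h.2 : Fin 1 → ℝ) = vertex C v}.encard

/-- A core graph: a finite graph all of whose vertices have valence at least two (there are no
vertices of valence one and no isolated points). -/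
structure IsCore (C : Set X) [CWComplex C] : Prop extends IsFiniteGraph C where
  two_le_valence : ∀ v : RelCWComplex.cell C 0, 2 ≤ valence C v

/-- The subspace `K` is a core graph for some CW structure. -/
def IsCoreGraph (K : Set X) : Prop :=
  ∃ _ : CWComplex K, IsCore K

/-- The maximal core subgraph of a subspace `Y`: the union of all subspaces of `Y` that are core
graphs. If `Y` is a graph, a subspace of `Y` that is a core graph is a subgraph of `Y`
automatically: it is closed, and it has no free ends, so its intersection with each open edge
of `Y` is open and closed in that edge. -/
def maximalCore (Y : Set X) : Set X :=
  ⋃₀ {K : Set X | K ⊆ Y ∧ IsCoreGraph K}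

end Graphs

/-- The pullback (fibered product) of two maps, as a subspace of the product. -/
def pullback {A B G : Type*} (g : A → G) (h : B → G) : Set (A × B) :=
  {p | g p.1 = h p.2}

section SelfMaps

variable {X : Type u} [TopologicalSpace X]

/-- The `i`-th iterate of `f`, as a continuous map. -/
def iter (f : C(X, X)) (i : ℕ) : C(X, X) := ⟨f^[i], f.continuous.iterate i⟩

/-- `Γ_i`, the pullback of `f^i` with itself. As `f^0` is the identity, `Γ_0` is the diagonal. -/
def iteratedPullback (f : C(X, X)) (i : ℕ) : Set (X × X) :=
  pullback (iter f i) (iter f i)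

/-- `Γ̂_i`, the maximal core subgraph of `Γ_i - Γ_{i-1}`; only used for `i ≥ 1`. -/
def pullbackCore (f : C(X, X)) (i : ℕ) : Set (X × X) :=
  maximalCore (iteratedPullback f i \ iteratedPullback f (i - 1))

/-- The `d`-th power of a loop `σ : ℝ/ℤ → X`, which runs `d` times around `σ`. -/
def loopPow (σ : C(UnitAddCircle, X)) (d : ℕ) : C(UnitAddCircle, X) :=
  ⟨fun t => σ (d • t), σ.continuous.comp (continuous_nsmul d)⟩

/-- `f` has an invariant loop of degree `d`: for some `k ≥ 1` and some loop `σ` that is not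
homotopic to a constant, `f^k ∘ σ` is freely homotopic to `σ^d`. -/
def HasInvariantLoop (f : C(X, X)) (d : ℕ) : Prop :=
  1 ≤ d ∧ ∃ k : ℕ, 1 ≤ k ∧ ∃ σ : C(UnitAddCircle, X), ¬ σ.Nullhomotopic ∧
    ((iter f k).comp σ).Homotopic (loopPow σ d)

end SelfMaps

end GraphImmersion

/-!
An immersion `f` of a finite graph is studied through the immersed periodic lines `ℝ → Γ`. Each
of them is, up to an increasing reparametrization, the line `ArcSystem.line w` that runs through a
reduced bi-infinite periodic word `w` of oriented edges (`ArcSystem.IsGraph.exists_normalForm`),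
and two lines of words that are reparametrizations of each other differ by a shift of the index
(`ArcSystem.exists_shift_of_line_comp_eq`).

A nonempty core in `Γ_{i+1} \ Γ_i` contains a nonbacktracking circuit, hence a pair `(x, y)` of
immersed periodic lines with `f^(i+1) x = f^(i+1) y` that is disjoint from `Γ_i`
(`exists_lines_of_nonempty_pullbackCore`). As the sets `Γ_{i+1} \ Γ_i` are disjoint and there are
finitely many pairs of vertices, there is `N` such that for `i ≥ N` no pair of vertices lies in
`Γ_{i+1} \ Γ_i`. At the level `N` there is then no branching: at each time one of the two lines
is inside an edge and has to go straight on, which determines the common image and so the other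
line. Hence the common image line `f^(N+1) x = f^(N+1) y` has a period bounded by a number of
states (`ArcSystem.IsGraph.word_periodic_of_lifts`).

Now take a pair `(x, y)` at the level `N + k`, and consider the tower of pairs `(f^l x, f^l y)` for
`l ≤ k`. All these lines are lifts, through powers of `f`, of the single line
`f^(N+k+1) x = f^(N+k+1) y`, whose period is bounded independently of `k`. A lift is determined by
one of its vertices and the phase of that vertex below, so its word has a period that is bounded
independently of `k` as well (`ArcSystem.IsGraph.exists_normalForm_of_lift`). If `k` is large, two
pairs of the tower have the same words. This means that some power `f^p` maps the closed line
under `f^l x`, and likewise the one under `f^l y`, to itself. If it did so with degree one on the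
first, then its powers would be injective there, which would force `f^l x = f^l y`
(`ArcSystem.eq_of_degree_one`). So the degree is at least two, and the closed line is an invariant
loop (`ArcSystem.IsGraph.hasInvariantLoop`).

A closed reduced line is not nullhomotopic: it does not lift to a closed path in the covering
`ArcSystem.sheetCover` with fiber the free group on the edges
(`ArcSystem.IsGraph.not_nullhomotopic`). The hypothesis on the valence is used through
`ArcSystem.IsGraph.map_mem_vert`: three germs of arcs at a point do not embed in an open edge.
-/

open Set Filter Topology

namespace GraphImmersion

/-! ### Arc systems and the lines they carry -/

/-- The orientation reversal of an oriented edge `(e, b)`. -/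
def rev {E : Type*} (d : E × Bool) : E × Bool := (d.1, !d.2)

@[simp] lemma rev_rev {E : Type*} (d : E × Bool) : rev (rev d) = d := by simp [rev]

lemma rev_ne {E : Type*} (d : E × Bool) : rev d ≠ d := by
  obtain ⟨e, b⟩ := d
  cases b <;> simp [rev]

/-- A family of arcs in `X`, indexed by oriented edges, with disjoint interiors and with endpoints
in a set of vertices. Only the values of `arc d` on the unit interval matter. No topological
relation between the arcs and `X` is required beyond continuity, so that the edges of a subgraph
of `X` form an arc system in `X`. -/
structure ArcSystem (E X : Type*) [TopologicalSpace X] where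
  vert : Set X
  arc : E × Bool → ℝ → X
  continuousOn_arc : ∀ d, ContinuousOn (arc d) (Icc 0 1)
  arc_rev : ∀ d s, arc (rev d) s = arc d (1 - s)
  arc_zero_mem : ∀ d, arc d 0 ∈ vert
  arc_notMem : ∀ d, ∀ s ∈ Ioo (0 : ℝ) 1, arc d s ∉ vert
  arc_inj : ∀ d d', ∀ s ∈ Ioo (0 : ℝ) 1, ∀ s' ∈ Ioo (0 : ℝ) 1, arc d s = arc d' s' →
    (d' = d ∧ s' = s) ∨ (d' = rev d ∧ s' = 1 - s)

namespace ArcSystem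

variable {E X : Type*} [TopologicalSpace X] (A : ArcSystem E X)

lemma arc_one_mem (d : E × Bool) : A.arc d 1 ∈ A.vert := by
  have := A.arc_zero_mem (rev d)
  rwa [A.arc_rev, sub_zero] at this

lemma arc_injOn (d : E × Bool) : InjOn (A.arc d) (Ioo 0 1) := by
  intro s hs s' hs' h
  rcases A.arc_inj d d s hs s' hs' h with h | h
  · exact h.2.symm
  · exact absurd h.1.symm (rev_ne d)

/-- The bi-infinite path that runs through the oriented edge `w n` during the time interval
`[n, n + 1]`. -/
noncomputable def line (w : ℤ → E × Bool) (t : ℝ) : X := A.arc (w ⌊t⌋) (Int.fract t)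

/-- Consecutive oriented edges of `w` fit together. -/
def IsPath (w : ℤ → E × Bool) : Prop := ∀ n, A.arc (w n) 1 = A.arc (w (n + 1)) 0

end ArcSystem

/-- The bi-infinite word `w` in oriented edges has no backtracking. -/
def IsReducedWord {E : Type*} (w : ℤ → E × Bool) : Prop := ∀ n, w (n + 1) ≠ rev (w n)

namespace ArcSystem

variable {E X : Type*} [TopologicalSpace X] {A : ArcSystem E X} {w w' : ℤ → E × Bool}

lemma line_eq (hw : A.IsPath w) {n : ℤ} {t : ℝ} (ht : t ∈ Icc (n : ℝ) (n + 1)) :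
    A.line w t = A.arc (w n) (t - n) := by
  rcases eq_or_lt_of_le ht.2 with h | h
  · have h1 : ⌊t⌋ = n + 1 := by rw [h]; simp
    rw [line, h1, Int.fract, h1, h]
    simp [hw n]
  · have h1 : ⌊t⌋ = n := Int.floor_eq_iff.2 ⟨ht.1, h⟩
    rw [line, Int.fract, h1]

lemma continuous_line (hw : A.IsPath w) : Continuous (A.line w) := by
  have hloc : ∀ n : ℤ, ContinuousOn (A.line w) (Icc (n : ℝ) (n + 1)) := by
    intro n
    refine ContinuousOn.congr (f := fun t : ℝ => A.arc (w n) (t - n)) ?_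
      (fun t ht => line_eq hw ht)
    refine (A.continuousOn_arc (w n)).comp (by fun_prop) ?_
    intro t ht
    constructor <;> linarith [ht.1, ht.2]
  refine LocallyFinite.continuous (f := fun n : ℤ => Icc (n : ℝ) (n + 1)) ?_ ?_
    (fun _ => isClosed_Icc) hloc
  · intro t
    refine ⟨Ioo (t - 1) (t + 1), Ioo_mem_nhds (by linarith) (by linarith), ?_⟩
    refine (finite_Icc (⌊t⌋ - 3) (⌊t⌋ + 3)).subset ?_
    rintro n ⟨s, hs, hs'⟩
    have h1 := Int.floor_le t
    have h2 := Int.lt_floor_add_one t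
    constructor
    · have : (⌊t⌋ : ℝ) - 3 ≤ n := by linarith [hs.1, hs.2, hs'.1, hs'.2]
      exact_mod_cast this
    · have : (n : ℝ) ≤ ⌊t⌋ + 3 := by linarith [hs.1, hs.2, hs'.1, hs'.2]
      exact_mod_cast this
  · rw [eq_univ_iff_forall]
    intro t
    exact mem_iUnion.2 ⟨⌊t⌋, Int.floor_le t, (Int.lt_floor_add_one t).le⟩

lemma fract_mem_Ioo {t : ℝ} (ht : Int.fract t ≠ 0) : Int.fract t ∈ Ioo (0 : ℝ) 1 :=
  ⟨lt_of_le_of_ne (Int.fract_nonneg t) (Ne.symm ht), Int.fract_lt_one t⟩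

variable (A w) in
lemma line_mem_vert_iff {t : ℝ} : A.line w t ∈ A.vert ↔ Int.fract t = 0 := by
  constructor
  · intro h
    by_contra h0
    exact A.arc_notMem _ _ (fract_mem_Ioo h0) h
  · intro h
    rw [line, h]
    exact A.arc_zero_mem _

lemma line_eq_line {t t' : ℝ} (h : A.line w t = A.line w' t') :
    (Int.fract t = 0 ∧ Int.fract t' = 0) ∨ (w' ⌊t'⌋ = w ⌊t⌋ ∧ Int.fract t' = Int.fract t) ∨
      (w' ⌊t'⌋ = rev (w ⌊t⌋) ∧ Int.fract t' = 1 - Int.fract t) := by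
  by_cases h0 : Int.fract t = 0
  · left
    refine ⟨h0, ?_⟩
    rw [← line_mem_vert_iff A w', ← h, line_mem_vert_iff]
    exact h0
  · right
    have h0' : Int.fract t' ≠ 0 := by
      rwa [Ne, ← line_mem_vert_iff A w', ← h, line_mem_vert_iff]
    exact A.arc_inj _ _ _ (fract_mem_Ioo h0) _ (fract_mem_Ioo h0') h

lemma line_injective_of_lt (hr : IsReducedWord w) {t t' : ℝ} (htt : t < t') (ht' : t' < t + 1 / 2) :
    A.line w t ≠ A.line w t' := by
  intro h
  have e1 := Int.floor_add_fract t
  have e2 := Int.floor_add_fract t'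
  have a1 := Int.fract_nonneg t
  have a2 := Int.fract_nonneg t'
  have b1 := Int.fract_lt_one t
  have b2 := Int.fract_lt_one t'
  have hfl : ⌊t'⌋ = ⌊t⌋ ∨ ⌊t'⌋ = ⌊t⌋ + 1 := by
    have h1 : ⌊t⌋ ≤ ⌊t'⌋ := Int.floor_mono htt.le
    have h2 : ⌊t'⌋ < ⌊t⌋ + 2 := by
      have : (⌊t'⌋ : ℝ) < ⌊t⌋ + 2 := by linarith
      exact_mod_cast this
    omega
  rcases line_eq_line h with ⟨h1, h2⟩ | ⟨h1, h2⟩ | ⟨h1, h2⟩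
  · rcases hfl with hfl | hfl
    · rw [hfl] at e2; linarith
    · rw [hfl] at e2; push_cast at e2; linarith
  · rcases hfl with hfl | hfl
    · rw [hfl] at e2; linarith
    · rw [hfl] at e2; push_cast at e2; linarith
  · rcases hfl with hfl | hfl
    · rw [hfl] at h1
      exact rev_ne _ h1.symm
    · rw [hfl] at h1
      exact hr _ h1

lemma isLocallyInjective_line (hr : IsReducedWord w) : IsLocallyInjective (A.line w) := by
  intro t
  refine ⟨Ioo (t - 1 / 4) (t + 1 / 4), isOpen_Ioo, ⟨by linarith, by linarith⟩, ?_⟩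
  intro a ha b hb hab
  rcases lt_trichotomy a b with h | h | h
  · exact absurd hab (line_injective_of_lt hr h (by linarith [ha.1, hb.2]))
  · exact h
  · exact absurd hab.symm (line_injective_of_lt hr h (by linarith [hb.1, ha.2]))

/-- Two lines that are reparametrizations of each other differ by a shift of the index. -/
lemma exists_shift_of_line_comp_eq {h : ℝ ≃o ℝ} (he : ∀ t, A.line w (h t) = A.line w' t) :
    ∃ m : ℤ, (∀ t, h t = t + m) ∧ ∀ n, w' n = w (n + m) := by
  have hint : ∀ t, Int.fract (h t) = 0 ↔ Int.fract t = 0 := by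
    intro t
    rw [← line_mem_vert_iff A w, he, line_mem_vert_iff]
  -- `h` preserves the set of integers, hence maps each integer to the next one
  have hz : ∀ n : ℤ, ∃ m : ℤ, h n = m := by
    intro n
    have := (hint n).2 (by simp)
    rw [Int.fract_eq_zero_iff] at this
    obtain ⟨m, hm⟩ := this
    exact ⟨m, hm.symm⟩
  choose g hg using hz
  have hgs : ∀ n, g (n + 1) = g n + 1 := by
    intro n
    have h1 : g n < g (n + 1) := by
      have : h (n : ℝ) < h ((n + 1 : ℤ) : ℝ) := h.strictMono (by push_cast; linarith)
      rw [hg, hg] at this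
      exact_mod_cast this
    by_contra hne
    have h2 : g n + 1 < g (n + 1) := by omega
    have h3 : Int.fract (h.symm ((g n + 1 : ℤ) : ℝ)) = 0 := by
      rw [← hint, OrderIso.apply_symm_apply]
      simp
    rw [Int.fract_eq_zero_iff] at h3
    obtain ⟨k, hk⟩ := h3
    have h4 : h k = ((g n + 1 : ℤ) : ℝ) := by rw [hk, OrderIso.apply_symm_apply]
    have h5 : (n : ℝ) < k := h.lt_iff_lt.1 (by rw [h4, hg]; push_cast; linarith)
    have h6 : (k : ℝ) < ((n + 1 : ℤ) : ℝ) := h.lt_iff_lt.1 (by rw [h4, hg]; exact_mod_cast h2)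
    have h5' : n < k := by exact_mod_cast h5
    have h6' : k < n + 1 := by exact_mod_cast h6
    omega
  have hgn : ∀ n, g n = n + g 0 := by
    intro n
    induction n using Int.induction_on with
    | zero => simp
    | succ n ih => rw [hgs, ih]; ring
    | pred n ih =>
      have := hgs (-(n : ℤ) - 1)
      rw [sub_add_cancel, ih] at this
      linarith
  have hfloor : ∀ t, ⌊h t⌋ = ⌊t⌋ + g 0 := by
    intro t
    rw [← hgn, Int.floor_eq_iff, ← hg]
    constructor
    · exact h.monotone (Int.floor_le t)
    · have := h.strictMono (Int.lt_floor_add_one t)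
      have h2 := hg (⌊t⌋ + 1)
      push_cast at h2
      rw [h2, hgs] at this
      rw [hg]
      exact_mod_cast this
  have hmono : ∀ t s, ⌊t⌋ = ⌊s⌋ → t < s → Int.fract (h t) < Int.fract (h s) := by
    intro t s hts hlt
    have := h.strictMono hlt
    rw [← Int.floor_add_fract (h t), ← Int.floor_add_fract (h s), hfloor, hfloor, hts] at this
    linarith
  -- on each edge, `h` is increasing, so that edge cannot be run through backwards
  have hkey : ∀ t, Int.fract t ≠ 0 → w' ⌊t⌋ = w (⌊t⌋ + g 0) ∧ Int.fract t = Int.fract (h t) := by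
    intro t ht
    have hcase : ∀ s, ⌊s⌋ = ⌊t⌋ → Int.fract s ≠ 0 →
        (w' ⌊t⌋ = w (⌊t⌋ + g 0) ∧ Int.fract s = Int.fract (h s)) ∨
        (w' ⌊t⌋ = rev (w (⌊t⌋ + g 0)) ∧ Int.fract s = 1 - Int.fract (h s)) := by
      intro s hs hs0
      have := line_eq_line (he s)
      rw [hfloor, hs] at this
      rcases this with h1 | h1 | h1
      · exact absurd h1.2 hs0
      · exact Or.inl h1
      · exact Or.inr h1
    rcases hcase t rfl ht with h1 | h1
    · exact h1
    exfalso
    have ht1 := Int.fract_lt_one t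
    have ht0 : 0 < Int.fract t := lt_of_le_of_ne (Int.fract_nonneg t) (Ne.symm ht)
    obtain ⟨s, hst, hst'⟩ : ∃ s, t < s ∧ s < ⌊t⌋ + 1 :=
      exists_between (by linarith [Int.floor_add_fract t])
    have hsf : ⌊s⌋ = ⌊t⌋ := Int.floor_eq_iff.2 ⟨by linarith [Int.floor_le t], hst'⟩
    have hs0 : Int.fract s ≠ 0 := by
      have := Int.floor_add_fract s
      rw [hsf] at this
      have := Int.floor_le t
      intro h0
      linarith
    have hm := hmono t s hsf.symm hst
    have hlt : Int.fract t < Int.fract s := by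
      have e1 := Int.floor_add_fract s
      have e2 := Int.floor_add_fract t
      rw [hsf] at e1
      linarith
    rcases hcase s hsf hs0 with h2 | h2
    · rw [h1.1] at h2
      exact rev_ne _ h2.1
    · linarith [h1.2, h2.2]
  refine ⟨g 0, ?_, ?_⟩
  · intro t
    by_cases ht : Int.fract t = 0
    · have h2 := (hint t).2 ht
      rw [← Int.floor_add_fract (h t), hfloor, h2, ← Int.floor_add_fract t, ht]
      simp
    · rw [← Int.floor_add_fract (h t), hfloor, ← (hkey t ht).2]
      push_cast
      linarith [Int.floor_add_fract t]
  · intro n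
    have hf : ⌊(n : ℝ) + 1 / 2⌋ = n := Int.floor_eq_iff.2 ⟨by linarith, by linarith⟩
    have := (hkey (n + 1 / 2) ?_).1
    · rwa [hf] at this
    · rw [Int.fract, hf]
      norm_num

lemma line_shift (m : ℤ) (t : ℝ) : A.line w (t + m) = A.line (fun n => w (n + m)) t := by
  simp [line]

end ArcSystem

/-! ### Locally injective maps -/

lemma _root_.IsLocallyInjective.comp {X Y Z : Type*} [TopologicalSpace X] [TopologicalSpace Y]
    {g : Y → Z} {f : X → Y} (hg : IsLocallyInjective g) (hf : IsLocallyInjective f)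
    (hc : Continuous f) : IsLocallyInjective (g ∘ f) := by
  intro x
  obtain ⟨U, hU, hxU, hUi⟩ := hf x
  obtain ⟨W, hW, hxW, hWi⟩ := hg (f x)
  refine ⟨U ∩ f ⁻¹' W, hU.inter (hW.preimage hc), ⟨hxU, hxW⟩, ?_⟩
  intro a ha b hb hab
  exact hUi ha.1 hb.1 (hWi ha.2 hb.2 hab)

lemma _root_.IsLocallyInjective.iterate {X : Type*} [TopologicalSpace X] {f : X → X}
    (hf : IsLocallyInjective f) (hc : Continuous f) (n : ℕ) : IsLocallyInjective f^[n] := by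
  induction n with
  | zero => exact Function.injective_id.IsLocallyInjective
  | succ n ih => exact ih.comp hf hc

lemma _root_.IsLocallyInjective.finite_preimage {X Y : Type*} [TopologicalSpace X] {g : X → Y}
    (hg : IsLocallyInjective g) {F : Set Y} (hF : F.Finite) {K : Set X} (hK : IsCompact K) :
    (g ⁻¹' F ∩ K).Finite := by
  refine hK.induction_on (p := fun s => (g ⁻¹' F ∩ s).Finite) (by simp) ?_ ?_ ?_
  · intro s t hst ht
    exact ht.subset (inter_subset_inter_right _ hst)
  · intro s t hs ht
    rw [inter_union_distrib_left]
    exact hs.union ht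
  · intro x _
    obtain ⟨U, hU, hxU, hi⟩ := hg x
    refine ⟨U, mem_nhdsWithin_of_mem_nhds (hU.mem_nhds hxU), ?_⟩
    refine Finite.of_finite_image (f := g) (hF.subset ?_) (hi.mono inter_subset_right)
    rintro _ ⟨a, ha, rfl⟩
    exact ha.1

/-- A continuous locally injective function on an interval is strictly monotone, since it has no
interior local extremum. -/
lemma strictMonoOn_or_strictAntiOn_of_locallyInjOn {φ : ℝ → ℝ} {a b : ℝ} (hab : a < b)
    (hc : ContinuousOn φ (Ioo a b)) (hi : ∀ t ∈ Ioo a b, ∃ U ∈ 𝓝 t, InjOn φ U) :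
    StrictMonoOn φ (Ioo a b) ∨ StrictAntiOn φ (Ioo a b) := by
  refine hc.strictMonoOn_of_injOn_Ioo hab ?_
  have key : ∀ s ∈ Ioo a b, ∀ t ∈ Ioo a b, s < t → φ s ≠ φ t := by
    intro s hs t ht hst heq
    have hsub : Icc s t ⊆ Ioo a b := fun u hu => ⟨hs.1.trans_le hu.1, hu.2.trans_lt ht.2⟩
    obtain ⟨c, hcm, hex⟩ := exists_isLocalExtr_Ioo hst (hc.mono hsub) heq
    obtain ⟨U, hU, hUi⟩ := hi c (hsub ⟨hcm.1.le, hcm.2.le⟩)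
    have hnhds : U ∩ Ioo s t ∈ 𝓝 c := inter_mem hU (Ioo_mem_nhds hcm.1 hcm.2)
    have aux : ∀ ψ : ℝ → ℝ, ContinuousOn ψ (Icc s t) → InjOn ψ U → IsLocalMax ψ c → False := by
      intro ψ hψc hψi hψ
      obtain ⟨ε, hε, hball⟩ := Metric.mem_nhds_iff.1 (inter_mem hnhds hψ)
      have hIcc : Icc (c - ε / 2) (c + ε / 2) ⊆ Metric.ball c ε := by
        intro u hu
        rw [Metric.mem_ball, Real.dist_eq, abs_lt]
        constructor <;> linarith [hu.1, hu.2]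
      have hle : c - ε / 2 ≤ c + ε / 2 := by linarith
      have h1 : c - ε / 2 ∈ Icc (c - ε / 2) (c + ε / 2) := left_mem_Icc.2 hle
      have h2 : c + ε / 2 ∈ Icc (c - ε / 2) (c + ε / 2) := right_mem_Icc.2 hle
      have h0 : c ∈ Icc (c - ε / 2) (c + ε / 2) := ⟨by linarith, by linarith⟩
      rcases ContinuousOn.strictMonoOn_of_injOn_Icc' hle
        (hψc.mono fun u hu => Ioo_subset_Icc_self (hball (hIcc hu)).1.2)
        (hψi.mono fun u hu => (hball (hIcc hu)).1.1) with hm | hm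
      · exact absurd (hm h0 h2 (by linarith)) (not_lt.2 (hball (hIcc h2)).2)
      · exact absurd (hm h1 h0 (by linarith)) (not_lt.2 (hball (hIcc h1)).2)
    rcases hex with hex | hex
    · exact aux (fun u => -φ u) (hc.mono hsub).neg (fun x hx y hy h => hUi hx hy (neg_injective h))
        hex.neg
    · exact aux φ (hc.mono hsub) hUi hex
  intro s hs t ht h
  rcases lt_trichotomy s t with hst | hst | hst
  · exact absurd h (key s hs t ht hst)
  · exact hst
  · exact absurd h.symm (key t ht s hs hst)

/-! ### Reparametrization of the real line -/

/-- A closed discrete subset of the line that is unbounded in both directions is enumerated by the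
integers in increasing order. -/
lemma exists_strictMono_int_range_eq {S : Set ℝ} (hfin : ∀ a b, (S ∩ Icc a b).Finite)
    (hup : ∀ a, ∃ s ∈ S, a < s) (hdn : ∀ a, ∃ s ∈ S, s < a) :
    ∃ t : ℤ → ℝ, StrictMono t ∧ range t = S := by
  classical
  let _ : LocallyFiniteOrder S := LocallyFiniteOrder.ofFiniteIcc (fun a b => by
    refine Finite.of_finite_image (f := Subtype.val) ((hfin a b).subset ?_)
      Subtype.val_injective.injOn
    rintro _ ⟨x, hx, rfl⟩
    exact ⟨x.2, hx.1, hx.2⟩)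
  have : NoMaxOrder S := ⟨fun a => by
    obtain ⟨s, hs, h⟩ := hup a
    exact ⟨⟨s, hs⟩, h⟩⟩
  have : NoMinOrder S := ⟨fun a => by
    obtain ⟨s, hs, h⟩ := hdn a
    exact ⟨⟨s, hs⟩, h⟩⟩
  have : Nonempty S := by
    obtain ⟨s, hs, -⟩ := hup 0
    exact ⟨⟨s, hs⟩⟩
  let _ : SuccOrder S := LinearLocallyFiniteOrder.succOrder S
  let _ : PredOrder S := LinearLocallyFiniteOrder.predOrder S
  let e : S ≃o ℤ := orderIsoIntOfLinearSuccPredArch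
  refine ⟨fun n => e.symm n, fun m n h => e.symm.strictMono h, ?_⟩
  ext s
  constructor
  · rintro ⟨n, rfl⟩
    exact (e.symm n).2
  · intro hs
    exact ⟨e ⟨s, hs⟩, by simp⟩

/-- Increasing bijections `[t n, t (n + 1)) → [0, 1)` glue to an automorphism of the ordered
line. -/
lemma exists_orderIso_of_strictMonoOn {t : ℤ → ℝ} (hidx : ∀ x, ∃ n, x ∈ Ico (t n) (t (n + 1)))
    {s : ℤ → ℝ → ℝ} (hs : ∀ n, StrictMonoOn (s n) (Ico (t n) (t (n + 1))))
    (him : ∀ n, s n '' Ico (t n) (t (n + 1)) = Ico 0 1) (ht : StrictMono t) :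
    ∃ θ : ℝ ≃o ℝ, ∀ n, ∀ x ∈ Ico (t n) (t (n + 1)), θ x = n + s n x := by
  choose N hN using hidx
  have huniq : ∀ n x, x ∈ Ico (t n) (t (n + 1)) → N x = n := by
    intro n x hx
    have h1 : N x < n + 1 := ht.lt_iff_lt.1 ((hN x).1.trans_lt hx.2)
    have h2 : n < N x + 1 := ht.lt_iff_lt.1 (hx.1.trans_lt (hN x).2)
    omega
  have hmem : ∀ n, ∀ x ∈ Ico (t n) (t (n + 1)), s n x ∈ Ico (0 : ℝ) 1 := by
    intro n x hx
    rw [← him n]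
    exact mem_image_of_mem _ hx
  have hmono : StrictMono fun x => (N x : ℝ) + s (N x) x := by
    intro x y hxy
    have hle : N x ≤ N y := by
      have : N x < N y + 1 := ht.lt_iff_lt.1 ((hN x).1.trans_lt (hxy.trans (hN y).2))
      omega
    rcases hle.eq_or_lt with h | h
    · have hy := hN y
      rw [← h] at hy
      have := hs _ (hN x) hy hxy
      simp only [← h]
      linarith
    · have h1 := (hmem _ x (hN x)).2
      have h2 := (hmem _ y (hN y)).1
      have h3 : (N x : ℝ) + 1 ≤ N y := by exact_mod_cast h
      simp only
      linarith
  have hsurj : Function.Surjective fun x => (N x : ℝ) + s (N x) x := by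
    intro y
    have : Int.fract y ∈ Ico (0 : ℝ) 1 := ⟨Int.fract_nonneg y, Int.fract_lt_one y⟩
    rw [← him ⌊y⌋] at this
    obtain ⟨x, hx, hxy⟩ := this
    refine ⟨x, ?_⟩
    simp only
    rw [huniq _ x hx, hxy, Int.floor_add_fract]
  refine ⟨hmono.orderIsoOfSurjective _ hsurj, ?_⟩
  intro n x hx
  rw [StrictMono.coe_orderIsoOfSurjective, huniq n x hx]

namespace ArcSystem

variable {E X : Type*} [TopologicalSpace X]

/-! ### Normal form of immersed periodic lines in a finite graph -/

/-- The arc system `A` presents the whole space `X` as a finite graph: the arcs and vertices cover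
`X`, and each open arc is an open subset of `X` that carries a continuous coordinate. -/
structure IsGraph (A : ArcSystem E X) : Prop where
  finite_edges : Finite E
  finite_vert : A.vert.Finite
  cover : ∀ x, x ∈ A.vert ∨ ∃ d, ∃ s ∈ Ioo (0 : ℝ) 1, A.arc d s = x
  isOpen_arc : ∀ d, IsOpen (A.arc d '' Ioo 0 1)
  exists_coord : ∀ d, ∃ φ : X → ℝ, ContinuousOn φ (A.arc d '' Ioo 0 1) ∧
    ∀ s ∈ Ioo (0 : ℝ) 1, φ (A.arc d s) = s

variable {A : ArcSystem E X}

/-- A locally injective path that stays away from the vertices runs monotonically through the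
interior of one edge. -/
lemma IsGraph.exists_coord_of_avoids (hA : A.IsGraph) {x : ℝ → X} (hx : Continuous x)
    (hi : IsLocallyInjective x) {a b : ℝ} (hab : a < b) (hv : ∀ t ∈ Ioo a b, x t ∉ A.vert) :
    ∃ d, ∃ s : ℝ → ℝ, StrictMonoOn s (Ioo a b) ∧ ContinuousOn s (Ioo a b) ∧
      ∀ t ∈ Ioo a b, s t ∈ Ioo (0 : ℝ) 1 ∧ x t = A.arc d (s t) := by
  obtain ⟨t₀, ht₀⟩ : (Ioo a b).Nonempty := nonempty_Ioo.2 hab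
  obtain ⟨d, s₀, hs₀, hd⟩ := (hA.cover (x t₀)).resolve_left (hv t₀ ht₀)
  have hsub : Ioo a b ⊆ x ⁻¹' (A.arc d '' Ioo 0 1) := by
    refine isPreconnected_Ioo.subset_left_of_subset_union
      (v := ⋃ d' ∈ {d' | d' ≠ d ∧ d' ≠ rev d}, x ⁻¹' (A.arc d' '' Ioo 0 1))
      ((hA.isOpen_arc d).preimage hx)
      (isOpen_biUnion fun d' _ => (hA.isOpen_arc d').preimage hx) ?_ ?_
      ⟨t₀, ht₀, s₀, hs₀, hd⟩
    · rw [Set.disjoint_left]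
      rintro t ⟨u, hu, htu⟩ ht
      obtain ⟨d', ⟨hd1, hd2⟩, u', hu', htu'⟩ := mem_iUnion₂.1 ht
      rcases A.arc_inj d d' u hu u' hu' (htu.trans htu'.symm) with h | h
      · exact hd1 h.1
      · exact hd2 h.1
    · intro t ht
      obtain ⟨d', u, hu, htu⟩ := (hA.cover (x t)).resolve_left (hv t ht)
      by_cases h1 : d' = d
      · subst h1
        exact Or.inl ⟨u, hu, htu⟩
      by_cases h2 : d' = rev d
      · subst h2
        rw [A.arc_rev] at htu
        exact Or.inl ⟨1 - u, ⟨by linarith [hu.2], by linarith [hu.1]⟩, htu⟩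
      · exact Or.inr (mem_iUnion₂.2 ⟨d', ⟨h1, h2⟩, u, hu, htu⟩)
  obtain ⟨φ, hφc, hφ⟩ := hA.exists_coord d
  have hmem : ∀ t ∈ Ioo a b, φ (x t) ∈ Ioo (0 : ℝ) 1 ∧ x t = A.arc d (φ (x t)) := by
    intro t ht
    obtain ⟨u, hu, htu⟩ := hsub ht
    rw [← htu, hφ u hu]
    exact ⟨hu, rfl⟩
  have hcont : ContinuousOn (fun t => φ (x t)) (Ioo a b) := hφc.comp hx.continuousOn hsub
  have hinj : ∀ t ∈ Ioo a b, ∃ U ∈ 𝓝 t, InjOn (fun t => φ (x t)) U := by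
    intro t ht
    obtain ⟨U, hU, htU, hUi⟩ := hi t
    refine ⟨U ∩ Ioo a b, inter_mem (hU.mem_nhds htU) (isOpen_Ioo.mem_nhds ht), ?_⟩
    intro u hu v hv' huv
    refine hUi hu.1 hv'.1 ?_
    rw [(hmem u hu.2).2, (hmem v hv'.2).2]
    exact congrArg _ huv
  rcases strictMonoOn_or_strictAntiOn_of_locallyInjOn hab hcont hinj with h | h
  · exact ⟨d, _, h, hcont, hmem⟩
  · refine ⟨rev d, fun t => 1 - φ (x t), ?_, continuousOn_const.sub hcont, ?_⟩
    · intro u hu v hv' huv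
      have := h hu hv' huv
      simp only at this ⊢
      linarith
    · intro t ht
      obtain ⟨h1, h2⟩ := hmem t ht
      refine ⟨⟨by linarith [h1.2], by linarith [h1.1]⟩, ?_⟩
      rw [A.arc_rev, sub_sub_cancel]
      exact h2

/-- Between two consecutive visits to vertices, a locally injective path runs once through an
edge. -/
lemma IsGraph.exists_traversal [T2Space X] (hA : A.IsGraph) {x : ℝ → X} (hx : Continuous x)
    (hi : IsLocallyInjective x) {a b : ℝ} (hab : a < b) (hv : ∀ t ∈ Ioo a b, x t ∉ A.vert)
    (ha : x a ∈ A.vert) (hb : x b ∈ A.vert) :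
    ∃ d, ∃ s : ℝ → ℝ, StrictMonoOn s (Ico a b) ∧ s '' Ico a b = Ico 0 1 ∧
      (∀ t ∈ Ico a b, x t = A.arc d (s t)) ∧ x b = A.arc d 1 := by
  obtain ⟨d, s, hs, hsc, hmem⟩ := hA.exists_coord_of_avoids hx hi hab hv
  have hne : (Ioo a b).Nonempty := nonempty_Ioo.2 hab
  have himne : (s '' Ioo a b).Nonempty := hne.image s
  have hbelow : BddBelow (s '' Ioo a b) := ⟨0, by
    rintro _ ⟨t, ht, rfl⟩
    exact (hmem t ht).1.1.le⟩
  have habove : BddAbove (s '' Ioo a b) := ⟨1, by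
    rintro _ ⟨t, ht, rfl⟩
    exact (hmem t ht).1.2.le⟩
  -- the one-sided limits of the coordinate are `0` and `1`, as the ends are vertices
  have harc : ∀ L ∈ Icc (0 : ℝ) 1, ∀ l : Filter ℝ, l.NeBot → Tendsto s l (𝓝 L) →
      (∀ᶠ t in l, t ∈ Ioo a b) → ∀ c, l ≤ 𝓝 c → x c = A.arc d L := by
    intro L hL l hl hsl hlab c hc
    refine tendsto_nhds_unique (f := x) (l := l) (hx.continuousAt.mono_left hc) ?_
    refine Tendsto.congr' (f₁ := fun t => A.arc d (s t)) ?_ ?_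
    · filter_upwards [hlab] with t ht
      exact ((hmem t ht).2).symm
    · refine (A.continuousOn_arc d L hL).tendsto.comp ?_
      refine tendsto_nhdsWithin_iff.2 ⟨hsl, ?_⟩
      filter_upwards [hlab] with t ht
      exact Ioo_subset_Icc_self (hmem t ht).1
  obtain ⟨u, hu⟩ := hne
  have hlim0 := hs.monotoneOn.tendsto_nhdsWithin_Ioo_right ⟨u, hu⟩ hbelow
  have hlim1 := hs.monotoneOn.tendsto_nhdsWithin_Ioo_left ⟨u, hu⟩ habove
  have hL0 : 0 ≤ sInf (s '' Ioo a b) := le_csInf himne (by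
    rintro _ ⟨t, ht, rfl⟩
    exact (hmem t ht).1.1.le)
  have hL0' : sInf (s '' Ioo a b) < 1 :=
    (csInf_le hbelow (mem_image_of_mem s hu)).trans_lt (hmem u hu).1.2
  have hL1 : sSup (s '' Ioo a b) ≤ 1 := csSup_le himne (by
    rintro _ ⟨t, ht, rfl⟩
    exact (hmem t ht).1.2.le)
  have hL1' : 0 < sSup (s '' Ioo a b) :=
    (hmem u hu).1.1.trans_le (le_csSup habove (mem_image_of_mem s hu))
  have hxa := harc _ ⟨hL0, hL0'.le⟩ (𝓝[>] a) inferInstance hlim0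
    (Ioo_mem_nhdsGT hab) a nhdsWithin_le_nhds
  have hxb := harc _ ⟨hL1'.le, hL1⟩ (𝓝[<] b) inferInstance hlim1
    (Ioo_mem_nhdsLT hab) b nhdsWithin_le_nhds
  have hinf : sInf (s '' Ioo a b) = 0 := by
    rcases hL0.eq_or_lt with h | h
    · exact h.symm
    · exact absurd (hxa ▸ ha) (A.arc_notMem d _ ⟨h, hL0'⟩)
  have hsup : sSup (s '' Ioo a b) = 1 := by
    rcases hL1.eq_or_lt with h | h
    · exact h
    · exact absurd (hxb ▸ hb) (A.arc_notMem d _ ⟨hL1', h⟩)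
  rw [hinf] at hxa
  rw [hsup] at hxb
  have hsurj : Ioo (0 : ℝ) 1 ⊆ s '' Ioo a b := by
    intro y hy
    obtain ⟨_, ⟨t₁, ht₁, rfl⟩, h1⟩ := exists_lt_of_csInf_lt himne (by rw [hinf]; exact hy.1)
    obtain ⟨_, ⟨t₂, ht₂, rfl⟩, h2⟩ := exists_lt_of_lt_csSup himne (by rw [hsup]; exact hy.2)
    exact (isPreconnected_Ioo.image s hsc).Icc_subset (mem_image_of_mem s ht₁)
      (mem_image_of_mem s ht₂) ⟨h1.le, h2.le⟩
  have hioo : ∀ t ∈ Ico a b, t ≠ a → t ∈ Ioo a b :=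
    fun t ht hta => ⟨lt_of_le_of_ne ht.1 (Ne.symm hta), ht.2⟩
  refine ⟨d, fun t => if t = a then 0 else s t, ?_, ?_, ?_, hxb⟩
  · intro t ht t' ht' htt'
    have ht'a : t' ≠ a := (ht.1.trans_lt htt').ne'
    simp only [ht'a, if_false]
    by_cases hta : t = a
    · simp only [hta, if_true]
      exact (hmem t' (hioo t' ht' ht'a)).1.1
    · simp only [hta, if_false]
      exact hs (hioo t ht hta) (hioo t' ht' ht'a) htt'
  · ext y
    constructor
    · rintro ⟨t, ht, rfl⟩
      by_cases hta : t = a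
      · simp [hta]
      · simp only [hta, if_false]
        exact Ioo_subset_Ico_self (hmem t (hioo t ht hta)).1
    · intro hy
      rcases hy.1.eq_or_lt with h | h
      · exact ⟨a, ⟨le_rfl, hab⟩, by simp [h]⟩
      · obtain ⟨t, ht, rfl⟩ := hsurj ⟨h, hy.2⟩
        exact ⟨t, ⟨ht.1.le, ht.2⟩, by simp [ht.1.ne']⟩
  · intro t ht
    by_cases hta : t = a
    · simp [hta, hxa]
    · simp only [hta, if_false]
      exact (hmem t (hioo t ht hta)).2

/-- A locally injective path that takes the same value twice meets a vertex. -/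
lemma IsGraph.exists_mem_vert_of_eq (hA : A.IsGraph) {x : ℝ → X} (hx : Continuous x)
    (hi : IsLocallyInjective x) {a b : ℝ} (hab : a < b) (h : x a = x b) :
    ∃ t, x t ∈ A.vert := by
  by_contra! hv
  obtain ⟨d, s, hs, -, hmem⟩ := hA.exists_coord_of_avoids (a := a - 1) (b := b + 1) hx hi
    (by linarith) (fun t _ => hv t)
  have ha : a ∈ Ioo (a - 1) (b + 1) := ⟨by linarith, by linarith⟩
  have hb : b ∈ Ioo (a - 1) (b + 1) := ⟨by linarith, by linarith⟩
  have := hs ha hb hab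
  rw [(hmem a ha).2, (hmem b hb).2] at h
  exact this.ne (A.arc_injOn d (hmem a ha).1 (hmem b hb).1 h)

/-- Normal form: an immersed periodic line in a finite graph is, up to reparametrization, the line
of a reduced word. -/
lemma IsGraph.exists_normalForm [T2Space X] (hA : A.IsGraph) {x : ℝ → X} (hx : Continuous x)
    (hi : IsLocallyInjective x) {T : ℝ} (hT : 0 < T) (hper : Function.Periodic x T) :
    ∃ w, A.IsPath w ∧ IsReducedWord w ∧ ∃ θ : ℝ ≃o ℝ, ∀ t, x t = A.line w (θ t) := by
  have hfin : ∀ a b, (x ⁻¹' A.vert ∩ Icc a b).Finite := fun a b =>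
    hi.finite_preimage hA.finite_vert isCompact_Icc
  obtain ⟨t₀, ht₀⟩ := hA.exists_mem_vert_of_eq hx hi hT (by simpa using (hper 0).symm)
  have hshift : ∀ n : ℤ, t₀ + n * T ∈ x ⁻¹' A.vert := by
    intro n
    rw [mem_preimage, hper.int_mul n t₀]
    exact ht₀
  have hup : ∀ a, ∃ s ∈ x ⁻¹' A.vert, a < s := by
    intro a
    obtain ⟨n, hn⟩ := exists_int_gt ((a - t₀) / T)
    refine ⟨_, hshift n, ?_⟩
    rw [div_lt_iff₀ hT] at hn
    linarith
  have hdn : ∀ a, ∃ s ∈ x ⁻¹' A.vert, s < a := by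
    intro a
    obtain ⟨n, hn⟩ := exists_int_lt ((a - t₀) / T)
    refine ⟨_, hshift n, ?_⟩
    rw [lt_div_iff₀ hT] at hn
    linarith
  obtain ⟨t, ht, hrange⟩ := exists_strictMono_int_range_eq hfin hup hdn
  have htv : ∀ n, x (t n) ∈ A.vert := fun n => by
    have : t n ∈ x ⁻¹' A.vert := hrange ▸ mem_range_self n
    exact this
  have hbetween : ∀ n, ∀ u ∈ Ioo (t n) (t (n + 1)), x u ∉ A.vert := by
    intro n u hu huv
    have : u ∈ range t := hrange ▸ huv
    obtain ⟨m, rfl⟩ := this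
    have h1 := ht.lt_iff_lt.1 hu.1
    have h2 := ht.lt_iff_lt.1 hu.2
    omega
  have hidx : ∀ u, ∃ n, u ∈ Ico (t n) (t (n + 1)) := by
    intro u
    have hbd : ∃ b : ℤ, ∀ n, t n ≤ u → n ≤ b := by
      obtain ⟨s, hs, hus⟩ := hup u
      rw [← hrange] at hs
      obtain ⟨m, rfl⟩ := hs
      exact ⟨m, fun n hn => ht.le_iff_le.1 (hn.trans hus.le)⟩
    obtain ⟨s, hs, hsu⟩ := hdn u
    rw [← hrange] at hs
    obtain ⟨m, rfl⟩ := hs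
    obtain ⟨n, hn, hmax⟩ := Int.exists_greatest_of_bdd hbd ⟨m, hsu.le⟩
    refine ⟨n, hn, ?_⟩
    by_contra hlt
    have := hmax (n + 1) (not_lt.1 hlt)
    omega
  choose w s hs him hxs hend using fun n => hA.exists_traversal hx hi (ht (lt_add_one n))
    (hbetween n) (htv n) (htv (n + 1))
  obtain ⟨θ, hθ⟩ := exists_orderIso_of_strictMonoOn hidx hs him ht
  have hfl : ∀ n, ∀ u ∈ Ico (t n) (t (n + 1)), ⌊θ u⌋ = n ∧ Int.fract (θ u) = s n u := by
    intro n u hu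
    have hm : s n u ∈ Ico (0 : ℝ) 1 := him n ▸ mem_image_of_mem _ hu
    have h1 : ⌊θ u⌋ = n := by
      rw [Int.floor_eq_iff, hθ n u hu]
      exact ⟨by linarith [hm.1], by linarith [hm.2]⟩
    refine ⟨h1, ?_⟩
    rw [Int.fract, h1, hθ n u hu]
    ring
  have hline : ∀ u, x u = A.line w (θ u) := by
    intro u
    obtain ⟨n, hn⟩ := hidx u
    rw [line, (hfl n u hn).1, (hfl n u hn).2]
    exact hxs n u hn
  have hpath : A.IsPath w := by
    intro n
    rw [← hend n, hxs (n + 1) (t (n + 1)) ⟨le_rfl, ht (lt_add_one _)⟩]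
    congr 1
    -- the coordinate of the left end of a traversal is the least element of `[0, 1)`
    have h0 : (0 : ℝ) ∈ s (n + 1) '' Ico (t (n + 1)) (t (n + 1 + 1)) := by
      rw [him]
      exact ⟨le_rfl, one_pos⟩
    obtain ⟨u, hu, hu0⟩ := h0
    have hl : t (n + 1) ∈ Ico (t (n + 1)) (t (n + 1 + 1)) := ⟨le_rfl, ht (lt_add_one _)⟩
    have h1 : 0 ≤ s (n + 1) (t (n + 1)) := by
      have : s (n + 1) (t (n + 1)) ∈ Ico (0 : ℝ) 1 := him (n + 1) ▸ mem_image_of_mem _ hl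
      exact this.1
    have h2 := (hs (n + 1)).monotoneOn hl hu hu.1
    linarith
  refine ⟨w, hpath, ?_, θ, hline⟩
  intro n hn
  have hinj : IsLocallyInjective (A.line w) := by
    have : A.line w = x ∘ θ.symm := by
      ext u
      simp [hline]
    rw [this]
    exact hi.comp θ.symm.injective.IsLocallyInjective θ.symm.continuous
  obtain ⟨U, hU, hnU, hUi⟩ := hinj (n + 1 : ℝ)
  obtain ⟨ε, hε, hball⟩ := Metric.isOpen_iff.1 hU _ hnU
  obtain ⟨δ, hδ0, hδ⟩ : ∃ δ, 0 < δ ∧ δ < min ε 1 := exists_between (lt_min hε one_pos)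
  have hδ1 : δ < ε := hδ.trans_le (min_le_left _ _)
  have hδ2 : δ < 1 := hδ.trans_le (min_le_right _ _)
  have e : (n : ℝ) + 1 - δ = n + 1 + δ := by
    refine hUi (hball ?_) (hball ?_) ?_
    · rw [Metric.mem_ball, Real.dist_eq, abs_lt]
      constructor <;> linarith
    · rw [Metric.mem_ball, Real.dist_eq, abs_lt]
      constructor <;> linarith
    · rw [line_eq hpath (n := n) ⟨by linarith, by linarith⟩,
        line_eq hpath (n := n + 1) ⟨by push_cast; linarith, by push_cast; linarith⟩, hn, A.arc_rev]
      congr 1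
      push_cast
      ring
  linarith

end ArcSystem

/-! ### Reduced closed lines are not nullhomotopic -/

/-- The free group on the edges, as a discrete space: the set of sheets of the covering defined
below. -/
def Sheet (E : Type*) : Type _ := FreeGroup E

namespace Sheet

variable (E : Type*)

instance : Group (Sheet E) := inferInstanceAs (Group (FreeGroup E))

instance : TopologicalSpace (Sheet E) := ⊥

instance : DiscreteTopology (Sheet E) := ⟨rfl⟩

end Sheet

/-- The element of the free group given by an oriented edge: `(e, true)` is the generator `e`, and
`(e, false)` is its inverse. -/
def letter {E : Type*} (d : E × Bool) : Sheet E := FreeGroup.mk [d]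

lemma letter_rev {E : Type*} (d : E × Bool) : letter (rev d) = (letter d)⁻¹ := by
  obtain ⟨e, b⟩ := d
  change FreeGroup.mk _ = (FreeGroup.mk _)⁻¹
  simp [rev, FreeGroup.invRev]

/-- The partial products of the letters of a reduced word are nontrivial in the free group. -/
lemma apply_ne_apply_zero_of_mul_letter {E : Type*} {w : ℤ → E × Bool} (hr : IsReducedWord w)
    {g : ℤ → Sheet E} (hg : ∀ n, g (n + 1) = g n * letter (w n)) {m : ℕ} (hm : 0 < m) :
    g m ≠ g 0 := by
  classical
  let L : ℕ → List (E × Bool) := fun k => (List.range k).map fun i : ℕ => w i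
  have hgL : ∀ k : ℕ, g k = g 0 * (show Sheet E from FreeGroup.mk (L k)) := by
    intro k
    induction k with
    | zero => exact (mul_one (g 0)).symm
    | succ k ih =>
      have : (FreeGroup.mk (L (k + 1)) : FreeGroup E) =
          FreeGroup.mk (L k) * FreeGroup.mk [w k] := by
        simp [L, List.range_succ]
      rw [Nat.cast_succ, hg, ih, mul_assoc]
      exact congrArg (g 0 * ·) this.symm
  have hred : ∀ k, FreeGroup.IsReduced (L k) := by
    intro k
    rcases k with _ | k
    · exact FreeGroup.IsReduced.nil
    · refine (List.isChain_map _).2 ((List.isChain_range_succ _ _).2 ?_)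
      intro i _ h1
      by_contra h2
      refine hr i ?_
      push_cast at h1 h2
      refine Prod.ext h1.symm ?_
      change (w (i + 1)).2 = !(w i).2
      revert h2
      cases (w (i : ℤ)).2 <;> cases (w ((i : ℤ) + 1)).2 <;> simp
  intro h
  have h1 : (FreeGroup.mk (L m) : FreeGroup E) = 1 :=
    mul_left_cancel (G := Sheet E) ((hgL m).symm.trans (h.trans (mul_one (g 0)).symm))
  have h2 := congrArg FreeGroup.toWord h1
  rw [FreeGroup.toWord_mk, (hred m).reduce_eq, FreeGroup.toWord_one] at h2
  have h3 := congrArg List.length h2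
  simp only [L, List.length_map, List.length_range, List.length_nil] at h3
  omega

namespace ArcSystem

variable {E X : Type*} [TopologicalSpace X] {A : ArcSystem E X}

variable (A) in
/-- The sets that trivialize the covering: the open edges, and the complement of the midpoints of
the edges. -/
def chart : Option E → Set X
  | none => (range fun e => A.arc (e, true) (1 / 2))ᶜ
  | some e => A.arc (e, true) '' Ioo 0 1

variable (A) in
open Classical in
/-- The coordinate change from the complement of the midpoints to the open edge `e` is right
multiplication by the inverse of the generator `e` on the second half of the edge, and trivial on
the first half. -/
noncomputable def twist : Option E → X → Sheet E
  | none, _ => 1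
  | some e, x => if x ∈ A.arc (e, true) '' Ioo (1 / 2) 1 then (letter (e, true))⁻¹ else 1

open Classical in
variable (A) in
/-- A chart around `x`. -/
noncomputable def chartAt (x : X) : Option E :=
  if h : ∃ e, A.arc (e, true) (1 / 2) = x then some h.choose else none

lemma mem_chart_chartAt (x : X) : x ∈ A.chart (A.chartAt x) := by
  unfold chartAt
  split_ifs with h
  · exact ⟨1 / 2, by norm_num, h.choose_spec⟩
  · simpa [chart] using h

lemma IsGraph.isOpen_chart [T2Space X] (hA : A.IsGraph) (i : Option E) : IsOpen (A.chart i) := by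
  have := hA.finite_edges
  cases i with
  | none => exact (finite_range _).isClosed.isOpen_compl
  | some e => exact hA.isOpen_arc _

lemma IsGraph.isOpen_image_Ioo (hA : A.IsGraph) (d : E × Bool) {a b : ℝ} (ha : 0 ≤ a)
    (hb : b ≤ 1) : IsOpen (A.arc d '' Ioo a b) := by
  obtain ⟨φ, hφc, hφ⟩ := hA.exists_coord d
  have : A.arc d '' Ioo a b = A.arc d '' Ioo 0 1 ∩ φ ⁻¹' Ioo a b := by
    ext x
    constructor
    · rintro ⟨s, hs, rfl⟩
      have hs' : s ∈ Ioo (0 : ℝ) 1 := ⟨ha.trans_lt hs.1, hs.2.trans_le hb⟩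
      refine ⟨⟨s, hs', rfl⟩, ?_⟩
      rw [mem_preimage, hφ s hs']
      exact hs
    · rintro ⟨⟨s, hs', rfl⟩, hs⟩
      rw [mem_preimage, hφ s hs'] at hs
      exact ⟨s, hs, rfl⟩
  rw [this]
  exact hφc.isOpen_inter_preimage (hA.isOpen_arc d) isOpen_Ioo

lemma twist_of_lt {e : E} {s : ℝ} (hs : s ∈ Ioo (0 : ℝ) (1 / 2)) :
    A.twist (some e) (A.arc (e, true) s) = 1 := by
  refine if_neg ?_
  rintro ⟨s', hs', h⟩
  have := A.arc_injOn _ ⟨by linarith [hs'.1], hs'.2⟩ ⟨hs.1, by linarith [hs.2]⟩ h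
  linarith [hs.2, hs'.1]

lemma twist_of_gt {e : E} {s : ℝ} (hs : s ∈ Ioo (1 / 2 : ℝ) 1) :
    A.twist (some e) (A.arc (e, true) s) = (letter (e, true))⁻¹ :=
  if_pos ⟨s, hs, rfl⟩

lemma IsGraph.continuousOn_twist (hA : A.IsGraph) (e : E) :
    ContinuousOn (A.twist (some e)) (A.chart none ∩ A.chart (some e)) := by
  rintro _ ⟨hx, s, hs, rfl⟩
  refine ContinuousAt.continuousWithinAt ?_
  have hne : s ≠ 1 / 2 := by
    rintro rfl
    exact hx ⟨e, rfl⟩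
  rcases lt_or_gt_of_ne hne with h | h
  · refine (continuousAt_const (y := (1 : Sheet E))).congr ?_
    filter_upwards [(hA.isOpen_image_Ioo (e, true) le_rfl (by norm_num : (1 / 2 : ℝ) ≤ 1)).mem_nhds
      ⟨s, ⟨hs.1, h⟩, rfl⟩]
    rintro _ ⟨s', hs', rfl⟩
    exact (twist_of_lt hs').symm
  · refine (continuousAt_const (y := (letter (e, true))⁻¹)).congr ?_
    filter_upwards [(hA.isOpen_image_Ioo (e, true) (by norm_num : (0 : ℝ) ≤ 1 / 2) le_rfl).mem_nhds
      ⟨s, ⟨h, hs.2⟩, rfl⟩]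
    rintro _ ⟨s', hs', rfl⟩
    exact (twist_of_gt hs').symm

lemma IsGraph.continuousOn_twist_inv_mul (hA : A.IsGraph) (i j : Option E) :
    ContinuousOn (fun x => (A.twist i x)⁻¹ * A.twist j x) (A.chart i ∩ A.chart j) := by
  cases i with
  | none =>
    cases j with
    | none => exact continuousOn_const
    | some e =>
      refine (hA.continuousOn_twist e).congr fun x _ => ?_
      change 1⁻¹ * A.twist (some e) x = _
      rw [inv_one, one_mul]
  | some e =>
    cases j with
    | none =>
      rw [inter_comm]
      exact (continuous_of_discreteTopology (f := fun g : Sheet E => g⁻¹ * 1)).comp_continuousOn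
        (hA.continuousOn_twist e)
    | some e' =>
      by_cases h : e = e'
      · subst h
        simpa using continuousOn_const
      · refine ContinuousOn.mono (continuousOn_empty _) ?_
        rintro _ ⟨⟨s, hs, rfl⟩, s', hs', h'⟩
        rcases A.arc_inj _ _ s' hs' s hs h' with h1 | h1
        · exact h (congrArg Prod.fst h1.1)
        · exact h (congrArg Prod.fst h1.1)

/-- The covering of a finite graph with fiber the free group on the edges, such that crossing the
midpoint of an edge multiplies the sheet by the corresponding generator. -/
noncomputable def sheetCover [T2Space X] (hA : A.IsGraph) :
    FiberBundleCore (Option E) X (Sheet E) where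
  baseSet := A.chart
  isOpen_baseSet := hA.isOpen_chart
  indexAt := A.chartAt
  mem_baseSet_at := mem_chart_chartAt
  coordChange i j x g := g * ((A.twist i x)⁻¹ * A.twist j x)
  coordChange_self i x _ g := by simp
  continuousOn_coordChange i j := by
    refine (continuous_of_discreteTopology
      (f := fun p : Sheet E × Sheet E => p.1 * p.2)).comp_continuousOn
      (f := fun p : X × Sheet E => (p.2, (A.twist i p.1)⁻¹ * A.twist j p.1)) ?_
    exact continuousOn_snd.prodMk
      ((hA.continuousOn_twist_inv_mul i j).comp continuousOn_fst fun p hp => hp.1)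
  coordChange_comp i j k x _ g := by group

/-- The sheet of a point of the covering, as seen in the chart `i`. -/
noncomputable def sheet [T2Space X] (hA : A.IsGraph) (i : Option E)
    (p : (sheetCover hA).TotalSpace) : Sheet E := ((sheetCover hA).localTriv i p).2

lemma sheet_some [T2Space X] (hA : A.IsGraph) (e : E) (p : (sheetCover hA).TotalSpace) :
    sheet hA (some e) p = sheet hA none p * A.twist (some e) p.1 := by
  let g : Sheet E := p.2
  change g * ((A.twist (A.chartAt p.1) p.1)⁻¹ * A.twist (some e) p.1) =
    g * ((A.twist (A.chartAt p.1) p.1)⁻¹ * 1) * A.twist (some e) p.1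
  group

lemma sheet_eq_of_isPreconnected [T2Space X] (hA : A.IsGraph) {y : ℝ → (sheetCover hA).TotalSpace}
    (hy : Continuous y) (i : Option E) {S : Set ℝ} (hS : IsPreconnected S)
    (h : ∀ t ∈ S, (y t).1 ∈ A.chart i) {a b : ℝ} (ha : a ∈ S) (hb : b ∈ S) :
    sheet hA i (y a) = sheet hA i (y b) := by
  refine hS.constant_of_mapsTo (T := univ) (isDiscrete_iff_discreteTopology.2 inferInstance)
    (f := fun t => sheet hA i (y t)) ?_
    (mapsTo_univ _ _) ha hb
  refine continuous_snd.comp_continuousOn ?_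
  refine ((sheetCover hA).localTriv i).continuousOn.comp hy.continuousOn ?_
  intro t ht
  rw [Bundle.Trivialization.mem_source]
  exact h t ht

/-- Running once through the edge `w n` multiplies the sheet by the letter `w n`. -/
lemma sheet_add_one [T2Space X] (hA : A.IsGraph) {w : ℤ → E × Bool} (hw : A.IsPath w)
    {y : ℝ → (sheetCover hA).TotalSpace} (hy : Continuous y) (hyw : ∀ t, (y t).1 = A.line w t)
    (n : ℤ) : sheet hA none (y ((n + 1 : ℤ) : ℝ)) = sheet hA none (y n) * letter (w n) := by
  have hmid : ∀ m : ℤ, ∀ t ∈ Ioo ((m : ℝ) - 1 / 2) (m + 1 / 2), (y t).1 ∈ A.chart none := by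
    rintro m t ht ⟨e, he⟩
    have hfr : Int.fract t ≠ 0 := by
      intro h0
      rw [← line_mem_vert_iff A w, ← hyw, ← he] at h0
      exact A.arc_notMem _ _ (by norm_num) h0
    simp only [hyw, line] at he
    have hhalf : Int.fract t = 1 / 2 := by
      rcases A.arc_inj _ _ _ (by norm_num) _ (fract_mem_Ioo hfr) he with h | h
      · exact h.2
      · rw [h.2]; norm_num
    have h1 := Int.floor_add_fract t
    rw [hhalf] at h1
    have h2 : ((m - 1 : ℤ) : ℝ) < ⌊t⌋ := by push_cast; linarith [ht.1]
    have h3 : (⌊t⌋ : ℝ) < m := by linarith [ht.2]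
    have h2' : m - 1 < ⌊t⌋ := by exact_mod_cast h2
    have h3' : ⌊t⌋ < m := by exact_mod_cast h3
    omega
  have hval : ∀ s ∈ Ioo (0 : ℝ) 1, (y (n + s)).1 = A.arc (w n) s := by
    intro s hs
    rw [hyw, line_eq hw (n := n) ⟨by linarith [hs.1], by linarith [hs.2]⟩]
    congr 1
    ring
  have hstart : sheet hA none (y n) = sheet hA none (y (n + 1 / 4)) :=
    sheet_eq_of_isPreconnected hA hy none isPreconnected_Ioo (hmid n)
      ⟨by linarith, by linarith⟩ ⟨by linarith, by linarith⟩
  have hfin : sheet hA none (y ((n + 1 : ℤ) : ℝ)) = sheet hA none (y (n + 3 / 4)) :=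
    sheet_eq_of_isPreconnected hA hy none isPreconnected_Ioo (hmid (n + 1))
      ⟨by linarith, by linarith⟩ ⟨by push_cast; linarith, by push_cast; linarith⟩
  have hacross : sheet hA (some (w n).1) (y (n + 1 / 4)) =
      sheet hA (some (w n).1) (y (n + 3 / 4)) := by
    refine sheet_eq_of_isPreconnected hA hy _ (S := Ioo (n : ℝ) (n + 1)) isPreconnected_Ioo ?_
      ⟨by linarith, by linarith⟩ ⟨by linarith, by linarith⟩
    intro t ht
    have hs : t - n ∈ Ioo (0 : ℝ) 1 := ⟨by linarith [ht.1], by linarith [ht.2]⟩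
    have := hval (t - n) hs
    rw [add_sub_cancel] at this
    rw [this]
    rcases hd : w n with ⟨e, b⟩
    cases b with
    | true => exact ⟨_, hs, rfl⟩
    | false =>
      refine ⟨1 - (t - n), ⟨by linarith [hs.2], by linarith [hs.1]⟩, ?_⟩
      rw [← A.arc_rev]
      rfl
  rw [sheet_some, sheet_some, hval _ (by norm_num), hval _ (by norm_num), ← hstart, ← hfin]
    at hacross
  rcases hd : w n with ⟨e, b⟩
  rw [hd] at hacross
  cases b with
  | true =>
    rw [twist_of_lt (by norm_num), twist_of_gt (by norm_num), mul_one] at hacross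
    rw [hacross, inv_mul_cancel_right]
  | false =>
    have hrev : ∀ s, A.arc (e, false) s = A.arc (e, true) (1 - s) := fun s => A.arc_rev (e, true) s
    rw [hrev, hrev, twist_of_gt (by norm_num), twist_of_lt (by norm_num), mul_one] at hacross
    rw [← hacross, ← letter_rev]
    rfl

/-- A loop that runs through a reduced line is not nullhomotopic: a lift of it to the covering
`sheetCover` would be closed, but its sheets differ by a nontrivial reduced word in the free
group. -/
lemma IsGraph.not_nullhomotopic [T2Space X] (hA : A.IsGraph) {w : ℤ → E × Bool} (hw : A.IsPath w)
    (hr : IsReducedWord w) {m : ℕ} (hm : 0 < m) (σ : C(UnitAddCircle, X))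
    (hσ : ∀ s : ℝ, σ (s : UnitAddCircle) = A.line w (m * s)) : ¬ σ.Nullhomotopic := by
  rintro ⟨x, ⟨H⟩⟩
  have hcov : IsCoveringMap (sheetCover hA).proj := FiberBundle.isCoveringMap
  let p₀ : (sheetCover hA).TotalSpace := ⟨x, (1 : Sheet E)⟩
  let H' : C(unitInterval × UnitAddCircle, X) := H.symm.toContinuousMap
  have H0 : ∀ a, H' (0, a) = (sheetCover hA).proj ((ContinuousMap.const UnitAddCircle p₀) a) :=
    fun a => H.symm.apply_zero a
  have H1 : ∀ a, H' (1, a) = σ a := fun a => H.symm.apply_one a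
  let σ' := hcov.liftHomotopy H' _ H0
  have hσ' : ∀ a, (σ' (1, a)).1 = σ a := fun a =>
    (congrFun (hcov.liftHomotopy_lifts H' _ H0) (1, a)).trans (H1 a)
  let y : ℝ → (sheetCover hA).TotalSpace := fun t => σ' (1, ((t / m : ℝ) : UnitAddCircle))
  have hm' : (m : ℝ) ≠ 0 := by positivity
  have hyc : Continuous y := by
    refine σ'.continuous.comp (continuous_const.prodMk ?_)
    exact (AddCircle.continuous_mk' 1).comp (by fun_prop)
  have hyw : ∀ t, (y t).1 = A.line w t := by
    intro t
    rw [hσ', hσ, mul_div_cancel₀ t hm']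
  have hper : y (m : ℝ) = y 0 := by
    have : (((m : ℝ) / m : ℝ) : UnitAddCircle) = ((0 / m : ℝ) : UnitAddCircle) := by
      rw [div_self hm', zero_div]
      exact AddCircle.coe_period 1
    simp only [y, this]
  refine apply_ne_apply_zero_of_mul_letter hr (g := fun n => sheet hA none (y n))
    (fun n => sheet_add_one hA hw hyc hyw n) hm ?_
  simp only [Int.cast_natCast, Int.cast_zero, hper]

end ArcSystem

/-! ### The arc system of a one-dimensional CW complex -/

section CW

variable {X : Type*} [TopologicalSpace X] (C : Set X) [CWComplex C]

lemma const_mem_closedBall {r : ℝ} (hr : r ∈ Icc (-1 : ℝ) 1) :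
    (fun _ => r : Fin 1 → ℝ) ∈ Metric.closedBall (0 : Fin 1 → ℝ) 1 := by
  rw [mem_closedBall_zero_iff, pi_norm_const, Real.norm_eq_abs, abs_le]
  exact hr

lemma const_mem_ball {r : ℝ} (hr : r ∈ Ioo (-1 : ℝ) 1) :
    (fun _ => r : Fin 1 → ℝ) ∈ Metric.ball (0 : Fin 1 → ℝ) 1 := by
  rw [mem_ball_zero_iff, pi_norm_const, Real.norm_eq_abs, abs_lt]
  exact hr

lemma const_mem_sphere {r : ℝ} (hr : r = -1 ∨ r = 1) :
    (fun _ => r : Fin 1 → ℝ) ∈ Metric.sphere (0 : Fin 1 → ℝ) 1 := by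
  rw [mem_sphere_zero_iff_norm, pi_norm_const, Real.norm_eq_abs]
  rcases hr with rfl | rfl <;> simp

/-- The affine parameter on `[-1, 1]` of an oriented edge. -/
noncomputable def edgeParam (b : Bool) (s : ℝ) : ℝ := if b then 2 * s - 1 else 1 - 2 * s

lemma edgeParam_mem_Icc (b : Bool) {s : ℝ} (hs : s ∈ Icc (0 : ℝ) 1) :
    edgeParam b s ∈ Icc (-1 : ℝ) 1 := by
  cases b <;> simp only [edgeParam] <;> constructor <;> norm_num <;> linarith [hs.1, hs.2]

lemma edgeParam_mem_Ioo (b : Bool) {s : ℝ} (hs : s ∈ Ioo (0 : ℝ) 1) :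
    edgeParam b s ∈ Ioo (-1 : ℝ) 1 := by
  cases b <;> simp only [edgeParam] <;> constructor <;> norm_num <;> linarith [hs.1, hs.2]

lemma continuous_edgeParam (b : Bool) : Continuous (edgeParam b) := by
  unfold edgeParam
  split_ifs <;> fun_prop

lemma map_mem_vertexSet (e : RelCWComplex.cell C 1) {r : ℝ} (hr : r = -1 ∨ r = 1) :
    RelCWComplex.map 1 e (fun _ => r) ∈ vertexSet C := by
  obtain ⟨x, y, hxy⟩ := CWComplex.exists_cellFrontier_one_eq e
  have h : RelCWComplex.map 1 e (fun _ => r) ∈ RelCWComplex.cellFrontier 1 e :=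
    mem_image_of_mem _ (const_mem_sphere hr)
  rw [hxy, RelCWComplex.closedCell_zero_eq_singleton, RelCWComplex.closedCell_zero_eq_singleton]
    at h
  rcases h with h | h
  · exact ⟨x, h.symm⟩
  · exact ⟨y, h.symm⟩

lemma disjoint_openCell_vertexSet (e : RelCWComplex.cell C 1) :
    Disjoint (RelCWComplex.openCell 1 e) (vertexSet C) := by
  rw [Set.disjoint_right]
  rintro _ ⟨v, rfl⟩ h
  have hd := RelCWComplex.disjoint_openCell_of_ne (C := C) (n := 1) (m := 0) (i := e) (j := v)
    (fun h => by simpa using congrArg Sigma.fst h)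
  refine Set.disjoint_left.1 hd h ?_
  rw [RelCWComplex.openCell_zero_eq_singleton]
  rfl

/-- The arc system formed by the vertices and edges of a CW complex. The edge with orientation
`true` runs through its parameter interval `[-1, 1]` from left to right. -/
noncomputable def arcSystem : ArcSystem (RelCWComplex.cell C 1) X where
  vert := vertexSet C
  arc d s := RelCWComplex.map 1 d.1 (fun _ => edgeParam d.2 s)
  continuousOn_arc d := by
    refine (RelCWComplex.continuousOn 1 d.1).comp (f := fun s : ℝ => (fun _ => edgeParam d.2 s))
      ?_ fun s hs => const_mem_closedBall (edgeParam_mem_Icc _ hs)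
    exact (continuous_pi fun _ => continuous_edgeParam _).continuousOn
  arc_rev d s := by
    obtain ⟨e, b⟩ := d
    cases b <;> simp only [rev, edgeParam] <;> norm_num <;> ring_nf
  arc_zero_mem d := by
    refine map_mem_vertexSet C _ ?_
    obtain ⟨e, b⟩ := d
    cases b <;> simp [edgeParam]
  arc_notMem d s hs h := Set.disjoint_left.1 (disjoint_openCell_vertexSet C d.1)
    (mem_image_of_mem _ (const_mem_ball (edgeParam_mem_Ioo d.2 hs))) h
  arc_inj := by
    rintro ⟨e, b⟩ ⟨e', b'⟩ s hs s' hs' h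
    have h1 := const_mem_ball (edgeParam_mem_Ioo b hs)
    have h2 := const_mem_ball (edgeParam_mem_Ioo b' hs')
    have he : e' = e := by
      by_contra hne
      refine Set.disjoint_left.1 (RelCWComplex.disjoint_openCell_of_ne (C := C) (n := 1) (m := 1)
        (i := e) (j := e') ?_) (mem_image_of_mem _ h1) (h ▸ mem_image_of_mem _ h2)
      intro h
      exact hne (by simpa using h.symm)
    subst he
    have hp := (RelCWComplex.map 1 e').injOn (by rw [RelCWComplex.source_eq]; exact h1)
      (by rw [RelCWComplex.source_eq]; exact h2) h
    have hp0 : edgeParam b s = edgeParam b' s' := congrFun hp 0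
    cases b <;> cases b' <;> simp [edgeParam, rev] at hp0 ⊢ <;> linarith

lemma arcSystem_arc_mem (d : RelCWComplex.cell C 1 × Bool) {s : ℝ} (hs : s ∈ Icc (0 : ℝ) 1) :
    (arcSystem C).arc d s ∈ C :=
  RelCWComplex.closedCell_subset_complex 1 d.1
    (mem_image_of_mem _ (const_mem_closedBall (edgeParam_mem_Icc d.2 hs)))

lemma arcSystem_line_mem (w : ℤ → RelCWComplex.cell C 1 × Bool) (t : ℝ) :
    (arcSystem C).line w t ∈ C :=
  arcSystem_arc_mem C _ ⟨Int.fract_nonneg t, (Int.fract_lt_one t).le⟩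

lemma image_arc_eq_openCell (d : RelCWComplex.cell C 1 × Bool) :
    (arcSystem C).arc d '' Ioo 0 1 = RelCWComplex.openCell 1 d.1 := by
  ext x
  constructor
  · rintro ⟨s, hs, rfl⟩
    exact mem_image_of_mem _ (const_mem_ball (edgeParam_mem_Ioo d.2 hs))
  · rintro ⟨p, hp, rfl⟩
    have hp' : p = fun _ => p 0 := by
      ext i
      rw [Subsingleton.elim i 0]
    rw [hp', mem_ball_zero_iff, pi_norm_const, Real.norm_eq_abs, abs_lt] at hp
    obtain ⟨e, b⟩ := d
    cases b with
    | true =>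
      refine ⟨(p 0 + 1) / 2, ⟨by linarith [hp.1], by linarith [hp.2]⟩, ?_⟩
      change RelCWComplex.map 1 e _ = _
      congr 1
      rw [hp']
      ext
      simp [edgeParam]
      ring
    | false =>
      refine ⟨(1 - p 0) / 2, ⟨by linarith [hp.2], by linarith [hp.1]⟩, ?_⟩
      change RelCWComplex.map 1 e _ = _
      congr 1
      rw [hp']
      ext
      simp [edgeParam]
      ring

variable {C}

lemma IsFiniteGraph.finite_cell (hC : IsFiniteGraph C) (n : ℕ) :
    Finite (RelCWComplex.cell C n) := by
  have := hC.finite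
  have := RelCWComplex.finite_cells_of_finite (C := C)
  exact Finite.of_injective (fun e => (⟨n, e⟩ : Σ n, RelCWComplex.cell C n))
    sigma_mk_injective

/-- Each edge end counted by the valence of a vertex is the start of an oriented edge. -/
lemma valence_le_encard (v : RelCWComplex.cell C 0) :
    valence C v ≤ {d | (arcSystem C).arc d 0 = vertex C v}.encard := by
  classical
  have hs : ∀ p : Metric.sphere (0 : Fin 1 → ℝ) 1,
      (p : Fin 1 → ℝ) = fun _ => edgeParam (decide ((p : Fin 1 → ℝ) 0 = -1)) 0 := by
    rintro ⟨p, hp⟩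
    have hp' : p = fun _ => p 0 := by
      ext i
      rw [Subsingleton.elim i 0]
    rw [hp', mem_sphere_zero_iff_norm, pi_norm_const, Real.norm_eq_abs] at hp
    ext i
    rw [Subsingleton.elim i 0]
    rcases (abs_eq one_pos.le).1 hp with h | h
    · simp only [h, edgeParam]
      norm_num
    · simp [h, edgeParam]
  refine encard_le_encard_of_injOn
    (f := fun h => (h.1, decide ((h.2 : Fin 1 → ℝ) 0 = -1))) ?_ ?_
  · rintro ⟨e, p⟩ h
    change RelCWComplex.map 1 e _ = _
    rw [← hs]
    exact h
  · rintro ⟨e, p⟩ _ ⟨e', p'⟩ _ h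
    simp only [Prod.mk.injEq] at h
    refine Prod.ext h.1 (Subtype.ext ?_)
    rw [hs p, hs p', h.2]

/-- A finite one-dimensional CW structure on a whole Hausdorff space presents it as a graph. -/
lemma IsFiniteGraph.isGraph [T2Space X] [CWComplex (univ : Set X)]
    (hX : IsFiniteGraph (univ : Set X)) : (arcSystem (univ : Set X)).IsGraph where
  finite_edges := hX.finite_cell 1
  finite_vert := by
    have := hX.finite_cell 0
    exact finite_range _
  cover x := by
    have hx : x ∈ (univ : Set X) := mem_univ x
    rw [← CWComplex.iUnion_openCell_eq_complex (C := (univ : Set X))] at hx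
    obtain ⟨n, j, hj⟩ := mem_iUnion₂.1 hx
    rcases n with _ | _ | n
    · left
      rw [RelCWComplex.openCell_zero_eq_singleton] at hj
      exact ⟨j, hj.symm⟩
    · right
      rw [← image_arc_eq_openCell univ (j, true)] at hj
      exact ⟨_, hj⟩
    · exact ((hX.dim_le_one (n + 2) (by omega)).false j).elim
  isOpen_arc d := by
    rw [image_arc_eq_openCell, ← isClosed_compl_iff]
    refine CWComplex.isClosed_of_disjoint_openCell_or_isClosed_inter_closedCell
      (C := (univ : Set X)) (subset_univ _) ?_
    intro n hn j
    rcases n with _ | _ | n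
    · omega
    · by_cases hj : j = d.1
      · subst hj
        exact Or.inl disjoint_compl_left
      · right
        have hsub : RelCWComplex.closedCell (0 + 1) j ⊆ (RelCWComplex.openCell 1 d.1)ᶜ := by
          rw [← RelCWComplex.cellFrontier_union_openCell_eq_closedCell]
          refine union_subset ?_ ?_
          · rw [RelCWComplex.cellFrontier_one_eq]
            rintro _ ⟨p, hp, rfl⟩ hmem
            refine Set.disjoint_left.1 (disjoint_openCell_vertexSet univ d.1) hmem ?_
            rcases hp with rfl | rfl
            · exact map_mem_vertexSet univ j (Or.inl rfl)
            · exact map_mem_vertexSet univ j (Or.inr rfl)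
          · refine disjoint_left.1 (RelCWComplex.disjoint_openCell_of_ne ?_)
            intro h
            exact hj (by simpa using h)
        rw [inter_eq_right.2 hsub]
        exact RelCWComplex.isClosed_closedCell
    · exact ((hX.dim_le_one (n + 2) (by omega)).false j).elim
  exists_coord d := by
    have htarget : (arcSystem (univ : Set X)).arc d '' Ioo 0 1 =
        (RelCWComplex.map (C := (univ : Set X)) 1 d.1).target := by
      rw [image_arc_eq_openCell, ← PartialEquiv.image_source_eq_target, RelCWComplex.source_eq]
      rfl
    have hsymm : ∀ s ∈ Ioo (0 : ℝ) 1, (RelCWComplex.map (C := (univ : Set X)) 1 d.1).symm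
        ((arcSystem (univ : Set X)).arc d s) = fun _ => edgeParam d.2 s := by
      intro s hs
      refine (RelCWComplex.map (C := (univ : Set X)) 1 d.1).left_inv ?_
      rw [RelCWComplex.source_eq]
      exact const_mem_ball (edgeParam_mem_Ioo d.2 hs)
    have hc := RelCWComplex.continuousOn_symm (C := (univ : Set X)) 1 d.1
    rw [← htarget] at hc
    have hc0 : ContinuousOn (fun x => (RelCWComplex.map (C := (univ : Set X)) 1 d.1).symm x 0)
      ((arcSystem (univ : Set X)).arc d '' Ioo 0 1) := (continuous_apply 0).comp_continuousOn hc
    obtain ⟨e, b⟩ := d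
    cases b with
    | true =>
      refine ⟨fun x => ((RelCWComplex.map (C := (univ : Set X)) 1 e).symm x 0 + 1) / 2,
        (hc0.add continuousOn_const).div_const 2, ?_⟩
      intro s hs
      simp only [hsymm s hs, edgeParam, if_true]
      ring
    | false =>
      refine ⟨fun x => (1 - (RelCWComplex.map (C := (univ : Set X)) 1 e).symm x 0) / 2,
        (continuousOn_const.sub hc0).div_const 2, ?_⟩
      intro s hs
      simp [hsymm s hs, edgeParam]

end CW

/-! ### Closed lines in core graphs -/

namespace ArcSystem

variable {E X : Type*} [TopologicalSpace X] {A : ArcSystem E X}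

/-- If every oriented edge can be continued without backtracking, then a finite arc system carries
a periodic reduced line. -/
lemma exists_periodic_word [Finite E] [Nonempty E]
    (hsucc : ∀ d, ∃ d', A.arc d' 0 = A.arc d 1 ∧ d' ≠ rev d) :
    ∃ w, A.IsPath w ∧ IsReducedWord w ∧ ∃ m : ℕ, 0 < m ∧ ∀ n, w (n + m) = w n := by
  choose next hnext hred using hsucc
  obtain ⟨e⟩ := ‹Nonempty E›
  obtain ⟨a, b, hab, heq⟩ := Finite.exists_ne_map_eq_of_infinite fun k : ℕ => next^[k] (e, true)
  wlog hlt : a < b generalizing a b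
  · exact this b a hab.symm heq.symm (lt_of_le_of_ne (not_lt.1 hlt) hab.symm)
  obtain ⟨m, rfl⟩ := Nat.exists_eq_add_of_lt hlt
  set p := next^[a] (e, true) with hp
  have hper : Function.IsPeriodicPt next (m + 1) p := by
    have : next^[m + 1 + a] (e, true) = p := by
      rw [hp, show next^[a] (e, true) = _ from heq]
      congr 1
      omega
    rwa [Function.iterate_add_apply] at this
  have hpos : (0 : ℤ) < (m + 1 : ℕ) := by positivity
  let w : ℤ → E × Bool := fun n => next^[(n % (m + 1 : ℕ)).toNat] p
  have hw : ∀ n, w (n + 1) = next (w n) := by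
    intro n
    have h1 : ((n + 1) % (m + 1 : ℕ)).toNat = ((n % (m + 1 : ℕ)).toNat + 1) % (m + 1) := by
      have h2 := Int.emod_nonneg n hpos.ne'
      have h3 := Int.emod_nonneg (n + 1) hpos.ne'
      zify
      push_cast at h2 h3 ⊢
      rw [Int.toNat_of_nonneg h3, Int.toNat_of_nonneg h2]
      rw [Int.emod_add_emod]
    simp only [w]
    rw [h1, hper.iterate_mod_apply, Function.iterate_succ_apply']
  refine ⟨w, fun n => ?_, fun n => ?_, m + 1, Nat.succ_pos m, fun n => ?_⟩
  · rw [hw, hnext]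
  · rw [hw]
    exact hred _
  · simp only [w]
    rw [Int.add_emod_right]

end ArcSystem

/-- A nonempty core graph contains the image of a periodic locally injective line. -/
lemma IsCoreGraph.exists_periodic_line {X : Type*} [TopologicalSpace X] {K : Set X}
    (hK : IsCoreGraph K) (hne : K.Nonempty) : ∃ x : ℝ → X, Continuous x ∧ IsLocallyInjective x ∧
      (∃ T : ℝ, 0 < T ∧ Function.Periodic x T) ∧ ∀ t, x t ∈ K := by
  obtain ⟨_, hK⟩ := hK
  have := hK.toIsFiniteGraph.finite_cell 1
  have hval : ∀ v : RelCWComplex.cell K 0,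
      1 < {d | (arcSystem K).arc d 0 = vertex K v}.encard := fun v =>
    lt_of_lt_of_le (by norm_num) ((hK.two_le_valence v).trans (valence_le_encard v))
  have hE : Nonempty (RelCWComplex.cell K 1) := by
    obtain ⟨x, hx⟩ := hne
    rw [← CWComplex.iUnion_openCell_eq_complex (C := K)] at hx
    obtain ⟨n, j, hj⟩ := mem_iUnion₂.1 hx
    rcases n with _ | _ | n
    · obtain ⟨d, -, -⟩ := one_lt_encard_iff.1 (hval j)
      exact ⟨d.1⟩
    · exact ⟨j⟩
    · exact ((hK.dim_le_one (n + 2) (by omega)).false j).elim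
  obtain ⟨w, hw, hr, m, hm, hper⟩ := (arcSystem K).exists_periodic_word fun d => by
    obtain ⟨v, hv⟩ := (arcSystem K).arc_one_mem d
    obtain ⟨d₁, d₂, h₁, h₂, hne⟩ := one_lt_encard_iff.1 (hval v)
    rw [← hv]
    by_cases h : d₁ = rev d
    · exact ⟨d₂, h₂, fun h' => hne (h.trans h'.symm)⟩
    · exact ⟨d₁, h₁, h⟩
  refine ⟨_, ArcSystem.continuous_line hw, ArcSystem.isLocallyInjective_line hr,
    ⟨m, by positivity, fun t => ?_⟩, fun t => arcSystem_line_mem K w t⟩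
  have := (arcSystem K).line_shift (w := w) m t
  push_cast at this
  rw [this]
  simp only [hper]

/-! ### Immersions preserve vertices of valence at least three -/

lemma exists_eq_of_strictMonoOn {g₁ g₂ : ℝ → ℝ} {ε : ℝ} (hε : 0 < ε)
    (h₁ : StrictMonoOn g₁ (Icc 0 ε)) (h₂ : StrictMonoOn g₂ (Icc 0 ε))
    (hc₁ : ContinuousOn g₁ (Icc 0 ε)) (hc₂ : ContinuousOn g₂ (Icc 0 ε)) (h0 : g₁ 0 = g₂ 0) :
    ∃ s ∈ Ioc 0 ε, ∃ s' ∈ Ioc 0 ε, g₁ s = g₂ s' := by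
  have hl : (0 : ℝ) ∈ Icc 0 ε := ⟨le_rfl, hε.le⟩
  have hr : ε ∈ Icc 0 ε := ⟨hε.le, le_rfl⟩
  have a₁ := h₁ hl hr hε
  have a₂ := h₂ hl hr hε
  have hpos : ∀ {g : ℝ → ℝ} {s y : ℝ}, s ∈ Icc 0 ε → g s = y → g 0 < y → s ∈ Ioc 0 ε := by
    intro g s y hs hsy hy
    refine ⟨lt_of_le_of_ne hs.1 ?_, hs.2⟩
    rintro rfl
    linarith
  obtain ⟨s, hs, hsy⟩ := intermediate_value_Icc hε.le hc₁
    (⟨le_min a₁.le (h0.trans_lt a₂).le, min_le_left _ _⟩ :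
      min (g₁ ε) (g₂ ε) ∈ Icc (g₁ 0) (g₁ ε))
  obtain ⟨s', hs', hsy'⟩ := intermediate_value_Icc hε.le hc₂
    (⟨le_min (h0.symm.trans_lt a₁).le a₂.le, min_le_right _ _⟩ :
      min (g₁ ε) (g₂ ε) ∈ Icc (g₂ 0) (g₂ ε))
  exact ⟨s, hpos hs hsy (lt_min a₁ (h0.trans_lt a₂)), s',
    hpos hs' hsy' (lt_min (h0.symm.trans_lt a₁) a₂), hsy.trans hsy'.symm⟩

namespace ArcSystem

variable {E X : Type*} [TopologicalSpace X] {A : ArcSystem E X}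

/-- A locally injective map sends a vertex of valence at least three to a vertex: of three germs of
arcs embedded in an open edge and starting at the same point, two must overlap. -/
lemma IsGraph.map_mem_vert (hA : A.IsGraph) {f : X → X} (hf : Continuous f)
    (hi : IsLocallyInjective f) {v : X} {d : Fin 3 → E × Bool} (hd : Function.Injective d)
    (hdv : ∀ i, A.arc (d i) 0 = v) : f v ∈ A.vert := by
  by_contra hfv
  have hv : v ∈ A.vert := hdv 0 ▸ A.arc_zero_mem _
  obtain ⟨d₀, s₀, hs₀, hfs₀⟩ := (hA.cover (f v)).resolve_left hfv
  obtain ⟨φ, hφc, hφ⟩ := hA.exists_coord d₀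
  obtain ⟨U, hU, hvU, hUi⟩ := hi v
  let O := A.arc d₀ '' Ioo 0 1
  have hφi : InjOn φ O := by
    rintro _ ⟨s, hs, rfl⟩ _ ⟨s', hs', rfl⟩ h
    rw [hφ s hs, hφ s' hs'] at h
    rw [h]
  have hW : U ∩ f ⁻¹' O ∈ 𝓝 v :=
    inter_mem (hU.mem_nhds hvU) (((hA.isOpen_arc d₀).preimage hf).mem_nhds ⟨s₀, hs₀, hfs₀⟩)
  have hε : ∀ i, ∃ ε : ℝ, 0 < ε ∧ ∀ s ∈ Icc (0 : ℝ) 1, s < ε → A.arc (d i) s ∈ U ∩ f ⁻¹' O := by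
    intro i
    have hc := A.continuousOn_arc (d i) 0 ⟨le_rfl, zero_le_one⟩
    rw [ContinuousWithinAt, hdv i] at hc
    obtain ⟨ε, hε, h⟩ := Metric.mem_nhdsWithin_iff.1 (hc hW)
    refine ⟨ε, hε, fun s hs hsε => h ⟨?_, hs⟩⟩
    rw [Metric.mem_ball, Real.dist_eq, sub_zero, abs_of_nonneg hs.1]
    exact hsε
  choose ε hε hεW using hε
  obtain ⟨δ, hδ0, hδ⟩ : ∃ δ, 0 < δ ∧ δ < min (1 / 2) (min (ε 0) (min (ε 1) (ε 2))) :=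
    exists_between (by simp [hε])
  simp only [lt_min_iff] at hδ
  obtain ⟨hδh, hδ₀, hδ₁, hδ₂⟩ := hδ
  have hδε : ∀ i, δ < ε i := by
    intro i
    fin_cases i
    exacts [hδ₀, hδ₁, hδ₂]
  have hmem : ∀ i, ∀ s ∈ Icc 0 δ, A.arc (d i) s ∈ U ∩ f ⁻¹' O := fun i s hs =>
    hεW i s ⟨hs.1, by linarith [hs.2]⟩ (hs.2.trans_lt (hδε i))
  have hIoo : ∀ s ∈ Ioc 0 δ, s ∈ Ioo (0 : ℝ) 1 := fun s hs => ⟨hs.1, by linarith [hs.2]⟩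
  let g : Fin 3 → ℝ → ℝ := fun i s => φ (f (A.arc (d i) s))
  have hgc : ∀ i, ContinuousOn (g i) (Icc 0 δ) := by
    intro i
    refine hφc.comp (hf.comp_continuousOn ((A.continuousOn_arc (d i)).mono ?_)) fun s hs =>
      (hmem i s hs).2
    exact Icc_subset_Icc_right (by linarith)
  have hgeq : ∀ i j, ∀ s ∈ Icc 0 δ, ∀ s' ∈ Icc 0 δ, g i s = g j s' →
      A.arc (d i) s = A.arc (d j) s' := fun i j s hs s' hs' h =>
    hUi (hmem i s hs).1 (hmem j s' hs').1 (hφi (hmem i s hs).2 (hmem j s' hs').2 h)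
  have harc : ∀ i, InjOn (A.arc (d i)) (Icc 0 δ) := by
    intro i s hs s' hs' h
    rcases hs.1.eq_or_lt with h0 | h0 <;> rcases hs'.1.eq_or_lt with h0' | h0'
    · exact h0.symm.trans h0'
    · rw [← h0] at h
      exact absurd (h ▸ A.arc_zero_mem _) (A.arc_notMem _ _ (hIoo s' ⟨h0', hs'.2⟩))
    · rw [← h0'] at h
      exact absurd (h ▸ A.arc_zero_mem _) (A.arc_notMem _ _ (hIoo s ⟨h0, hs.2⟩))
    · exact A.arc_injOn _ (hIoo s ⟨h0, hs.2⟩) (hIoo s' ⟨h0', hs'.2⟩) h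
  have hgm : ∀ i, StrictMonoOn (g i) (Icc 0 δ) ∨ StrictAntiOn (g i) (Icc 0 δ) := fun i =>
    (hgc i).strictMonoOn_of_injOn_Icc' hδ0.le fun s hs s' hs' h =>
      harc i hs hs' (hgeq i i s hs s' hs' h)
  have hg0 : ∀ i j, g i 0 = g j 0 := fun i j => by simp only [g, hdv]
  have hno : ∀ i j, i ≠ j → ∀ s ∈ Ioc 0 δ, ∀ s' ∈ Ioc 0 δ, g i s ≠ g j s' := by
    intro i j hij s hs s' hs' h
    rcases A.arc_inj _ _ s (hIoo s hs) s' (hIoo s' hs')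
      (hgeq i j s (Ioc_subset_Icc_self hs) s' (Ioc_subset_Icc_self hs') h) with h1 | h1
    · exact hij (hd h1.1).symm
    · linarith [h1.2, hs.2, hs'.2]
  have hmm : ∀ i j, i ≠ j → ¬(StrictMonoOn (g i) (Icc 0 δ) ∧ StrictMonoOn (g j) (Icc 0 δ)) := by
    rintro i j hij ⟨h1, h2⟩
    obtain ⟨s, hs, s', hs', h⟩ :=
      exists_eq_of_strictMonoOn hδ0 h1 h2 (hgc i) (hgc j) (hg0 i j)
    exact hno i j hij s hs s' hs' h
  have haa : ∀ i j, i ≠ j → ¬(StrictAntiOn (g i) (Icc 0 δ) ∧ StrictAntiOn (g j) (Icc 0 δ)) := by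
    rintro i j hij ⟨h1, h2⟩
    obtain ⟨s, hs, s', hs', h⟩ := exists_eq_of_strictMonoOn hδ0 h1.neg h2.neg (hgc i).neg
      (hgc j).neg (congrArg Neg.neg (hg0 i j))
    exact hno i j hij s hs s' hs' (neg_injective h)
  have h01 := hmm 0 1 (by decide)
  have h02 := hmm 0 2 (by decide)
  have h12 := hmm 1 2 (by decide)
  have h01' := haa 0 1 (by decide)
  have h02' := haa 0 2 (by decide)
  have h12' := haa 1 2 (by decide)
  have h0 := hgm 0
  have h1 := hgm 1
  have h2 := hgm 2
  tauto

end ArcSystem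

lemma mapsTo_vertexSet_of_three_le_valence {X : Type*} [TopologicalSpace X] [T2Space X]
    [CWComplex (univ : Set X)] (hX : IsFiniteGraph (univ : Set X)) {f : X → X} (hf : Continuous f)
    (hi : IsLocallyInjective f) (h3 : ∀ v, 3 ≤ valence (univ : Set X) v) :
    MapsTo f (vertexSet (univ : Set X)) (vertexSet (univ : Set X)) := by
  rintro _ ⟨v, rfl⟩
  obtain ⟨S, hS, hS3⟩ := exists_subset_encard_eq ((h3 v).trans (valence_le_encard v))
  obtain ⟨a, b, c, hab, hac, hbc, rfl⟩ := encard_eq_three.1 hS3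
  refine hX.isGraph.map_mem_vert hf hi (d := ![a, b, c]) ?_ ?_
  · intro i j hij
    fin_cases i <;> fin_cases j <;> simp_all
  · intro i
    fin_cases i
    · exact hS (by simp)
    · exact hS (by simp)
    · exact hS (by simp)

/-! ### Pigeonhole arguments for periods -/

lemma exists_lt_map_eq_of_finite {α : Type*} {S : Set α} (hS : S.Finite)
    {g : Fin (S.ncard + 1) → α} (hg : ∀ n, g n ∈ S) : ∃ a b, a < b ∧ g a = g b := by
  obtain ⟨a, -, b, -, hab, h⟩ := Finset.exists_ne_map_eq_of_card_lt_of_maps_to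
    (s := Finset.univ) (t := hS.toFinset) (f := g)
    (by rw [← ncard_eq_toFinset_card S hS]; simp) (fun n _ => by simpa using hg n)
  rcases lt_or_gt_of_ne hab with h' | h'
  · exact ⟨a, b, h', h⟩
  · exact ⟨b, a, h', h.symm⟩

lemma apply_add_mul_eq {α : Type*} {q : ℤ → α} {m : ℤ} (h : ∀ n, q (n + m) = q n) (k n : ℤ) :
    q (n + k * m) = q n := by
  have : Function.Periodic q m := h
  simpa using this.int_mul k n

lemma apply_add_factorial_eq {α : Type*} {q : ℤ → α} {m N : ℕ} (hm : 0 < m) (hmN : m ≤ N)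
    (h : ∀ n, q (n + m) = q n) (n : ℤ) : q (n + (N.factorial : ℕ)) = q n := by
  obtain ⟨k, hk⟩ := Nat.dvd_factorial hm hmN
  rw [hk, mul_comm]
  push_cast
  exact apply_add_mul_eq h k n

/-- A periodic sequence of states in a finite set, in which each state determines the next one, has
a period that depends only on the number of states. -/
lemma apply_add_factorial_ncard_eq {α : Type*} {S : Set α} (hS : S.Finite) {q : ℤ → α}
    (hq : ∀ n, q n ∈ S) (hstep : ∀ a b, q a = q b → q (a + 1) = q (b + 1)) {r : ℕ} (hr : 0 < r)
    (hper : ∀ n, q (n + r) = q n) (n : ℤ) : q (n + (S.ncard.factorial : ℕ)) = q n := by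
  obtain ⟨a, b, hab, h⟩ := exists_lt_map_eq_of_finite hS (g := fun i => q (i : ℕ))
    fun i => hq _
  obtain ⟨m, hm⟩ := Nat.exists_eq_add_of_lt (Fin.lt_def.1 hab)
  have hiter : ∀ l : ℕ, q ((a : ℕ) + l) = q ((b : ℕ) + l) := by
    intro l
    induction l with
    | zero => simpa using h
    | succ l ih =>
      have := hstep _ _ ih
      push_cast
      rwa [← add_assoc, ← add_assoc]
  refine apply_add_factorial_eq (m := m + 1) (Nat.succ_pos m) (by omega) ?_ n
  intro n
  -- a shift by a large multiple of `r` moves `n` into the range of `hiter`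
  obtain ⟨k, hk⟩ : ∃ k : ℕ, ((a : ℕ) : ℤ) ≤ n + k * r := by
    refine ⟨((a : ℕ) - n).toNat, ?_⟩
    have h1 : ((a : ℕ) : ℤ) - n ≤ (((a : ℕ) : ℤ) - n).toNat := Int.self_le_toNat _
    have h2 : (1 : ℤ) ≤ r := by exact_mod_cast hr
    nlinarith [Int.natCast_nonneg (((a : ℕ) : ℤ) - n).toNat]
  obtain ⟨l, hl⟩ := Int.eq_ofNat_of_zero_le (sub_nonneg.2 hk)
  rw [← apply_add_mul_eq hper k n, ← apply_add_mul_eq hper k (n + (m + 1 : ℕ))]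
  have e1 : n + k * r = (a : ℕ) + l := by linarith
  have e2 : n + (m + 1 : ℕ) + k * r = (b : ℕ) + l := by
    rw [hm]
    push_cast
    linarith
  rw [e1, e2, hiter]

namespace ArcSystem

variable {E X : Type*} [TopologicalSpace X] {A : ArcSystem E X}

lemma IsGraph.compactSpace (hA : A.IsGraph) : CompactSpace X := by
  have := hA.finite_edges
  refine ⟨?_⟩
  have : (univ : Set X) = A.vert ∪ ⋃ d, A.arc d '' Icc 0 1 := by
    symm
    rw [eq_univ_iff_forall]
    intro x
    rcases hA.cover x with h | ⟨d, s, hs, h⟩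
    · exact Or.inl h
    · exact Or.inr (mem_iUnion.2 ⟨d, s, Ioo_subset_Icc_self hs, h⟩)
  rw [this]
  exact hA.finite_vert.isCompact.union
    (isCompact_iUnion fun d => isCompact_Icc.image_of_continuousOn (A.continuousOn_arc d))

/-! ### Immersed lines through edge points go straight on -/

/-- Two locally injective paths that agree up to time `0`, when they are not at a vertex, overlap
immediately after that time. -/
lemma IsGraph.exists_eq_of_eqOn_left [T2Space X] (hA : A.IsGraph) {x x' : ℝ → X}
    (hx : Continuous x) (hi : IsLocallyInjective x) (hx' : Continuous x')
    (hi' : IsLocallyInjective x') (h : EqOn x x' (Icc (-1) 0)) (h0 : x 0 ∉ A.vert) {δ : ℝ}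
    (hδ : 0 < δ) : ∃ s ∈ Ioo 0 δ, ∃ s' ∈ Ioo 0 δ, x s = x' s' := by
  have h0' : x' 0 ∉ A.vert := by rwa [← h ⟨by norm_num, le_rfl⟩]
  have hopen : IsOpen (x ⁻¹' A.vertᶜ ∩ x' ⁻¹' A.vertᶜ) :=
    (hA.finite_vert.isClosed.isOpen_compl.preimage hx).inter
      (hA.finite_vert.isClosed.isOpen_compl.preimage hx')
  obtain ⟨ε₀, hε₀, hball⟩ := Metric.isOpen_iff.1 hopen 0 ⟨h0, h0'⟩
  obtain ⟨ε, hε, hεm⟩ : ∃ ε, 0 < ε ∧ ε < min 1 (min ε₀ δ) := exists_between (by simp [hε₀, hδ])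
  simp only [lt_min_iff] at hεm
  obtain ⟨hε1, hεε₀, hεδ⟩ := hεm
  have hav : ∀ t ∈ Ioo (-ε) ε, x t ∉ A.vert ∧ x' t ∉ A.vert := by
    intro t ht
    refine hball ?_
    rw [Metric.mem_ball, Real.dist_eq, abs_lt]
    constructor <;> linarith [ht.1, ht.2]
  obtain ⟨d, s, hs, hsc, hm⟩ := hA.exists_coord_of_avoids hx hi (by linarith : -ε < ε)
    fun t ht => (hav t ht).1
  obtain ⟨d', s', hs', hsc', hm'⟩ := hA.exists_coord_of_avoids hx' hi' (by linarith : -ε < ε)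
    fun t ht => (hav t ht).2
  have hcase : ∀ t ∈ Ioc (-ε) 0, (d' = d ∧ s' t = s t) ∨ (d' = rev d ∧ s' t = 1 - s t) := by
    intro t ht
    have ht' : t ∈ Ioo (-ε) ε := ⟨ht.1, by linarith [ht.2]⟩
    refine A.arc_inj _ _ _ (hm t ht').1 _ (hm' t ht').1 ?_
    rw [← (hm t ht').2, ← (hm' t ht').2]
    exact h ⟨by linarith [ht.1], ht.2⟩
  have hzero : (0 : ℝ) ∈ Ioc (-ε) 0 := ⟨by linarith, le_rfl⟩
  -- opposite directions are impossible, as both coordinates are increasing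
  have hsame : d' = d ∧ s' 0 = s 0 := by
    rcases hcase 0 hzero with h1 | h1
    · exact h1
    exfalso
    have hneg : -(ε / 2) ∈ Ioc (-ε) 0 := ⟨by linarith, by linarith⟩
    rcases hcase _ hneg with h2 | h2
    · exact rev_ne d (h1.1.symm.trans h2.1)
    · have m1 := hs (a := -(ε / 2)) (b := 0) ⟨by linarith, by linarith⟩ ⟨by linarith, hε⟩
        (by linarith)
      have m2 := hs' (a := -(ε / 2)) (b := 0) ⟨by linarith, by linarith⟩ ⟨by linarith, hε⟩
        (by linarith)
      linarith [h1.2, h2.2]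
  have hsub : Icc 0 (ε / 2) ⊆ Ioo (-ε) ε := fun t ht => ⟨by linarith [ht.1], by linarith [ht.2]⟩
  obtain ⟨a, ha, b, hb, hab⟩ := exists_eq_of_strictMonoOn (half_pos hε) (hs.mono hsub)
    (hs'.mono hsub) (hsc.mono hsub) (hsc'.mono hsub) hsame.2.symm
  refine ⟨a, ⟨ha.1, by linarith [ha.2]⟩, b, ⟨hb.1, by linarith [hb.2]⟩, ?_⟩
  rw [(hm a (hsub (Ioc_subset_Icc_self ha))).2, (hm' b (hsub (Ioc_subset_Icc_self hb))).2, hab,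
    hsame.1]

variable {w : ℤ → E × Bool}

/-- A lift of a line through an immersion `g` is determined on a unit interval by its starting
point and by the oriented edge below. -/
lemma eqOn_of_lift [T2Space X] (hw : A.IsPath w) {g : X → X} (hgi : IsLocallyInjective g)
    {x : ℝ → X} (hx : Continuous x) (hxw : ∀ t, g (x t) = A.line w t) {a b : ℤ}
    (h0 : x a = x b) (hab : w a = w b) :
    EqOn (fun s => x (a + s)) (fun s => x (b + s)) (Icc 0 1) := by
  refine (T2Space.isSeparatedMap g).eqOn_of_comp_eqOn hgi isPreconnected_Icc (by fun_prop)
    (by fun_prop) ?_ (a := 0) ⟨le_rfl, zero_le_one⟩ (by simpa using h0)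
  intro s hs
  simp only [Function.comp_apply]
  rw [hxw, hxw, line_eq hw (n := a) ⟨by linarith [hs.1], by linarith [hs.2]⟩,
    line_eq hw (n := b) ⟨by linarith [hs.1], by linarith [hs.2]⟩, hab]
  congr 1
  ring

/-- If moreover the lift ends in the interior of an edge, then it also determines the next oriented
edge below. -/
lemma IsGraph.word_add_one_eq_of_lift [T2Space X] (hA : A.IsGraph) (hw : A.IsPath w) {g : X → X}
    (hgi : IsLocallyInjective g) {x : ℝ → X} (hx : Continuous x) (hi : IsLocallyInjective x)
    (hxw : ∀ t, g (x t) = A.line w t) {a b : ℤ} (h0 : x a = x b) (hab : w a = w b)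
    (hv : x (a + 1) ∉ A.vert) : w (a + 1) = w (b + 1) := by
  have heq := eqOn_of_lift hw hgi hx hxw h0 hab
  have hshift : ∀ c : ℝ, IsLocallyInjective fun s => x (c + s) := fun c =>
    hi.comp (add_right_injective c).IsLocallyInjective (by fun_prop)
  obtain ⟨s, hs, s', hs', h⟩ := hA.exists_eq_of_eqOn_left (x := fun s => x ((a + 1 : ℝ) + s))
    (x' := fun s => x ((b + 1 : ℝ) + s)) (by fun_prop) (hshift _) (by fun_prop) (hshift _)
    (fun s hs => by
      have := heq (x := 1 + s) ⟨by linarith [hs.1], by linarith [hs.2]⟩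
      simpa only [add_assoc] using this)
    (by simpa using hv) (δ := 1 / 2) (by norm_num)
  have hfr : ∀ (n : ℤ) (u : ℝ), u ∈ Ioo (0 : ℝ) (1 / 2) →
      ⌊(n : ℝ) + 1 + u⌋ = n + 1 ∧ Int.fract ((n : ℝ) + 1 + u) = u := by
    intro n u hu
    have h1 : ⌊(n : ℝ) + 1 + u⌋ = n + 1 := by
      rw [Int.floor_eq_iff]
      push_cast
      constructor <;> linarith [hu.1, hu.2]
    refine ⟨h1, ?_⟩
    rw [Int.fract, h1]
    push_cast
    ring
  have hl : A.line w ((a : ℝ) + 1 + s) = A.line w ((b : ℝ) + 1 + s') := by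
    rw [← hxw, ← hxw]
    exact congrArg g h
  have hcases := line_eq_line hl
  rw [(hfr a s hs).1, (hfr a s hs).2, (hfr b s' hs').1, (hfr b s' hs').2] at hcases
  rcases hcases with h1 | h1 | h1
  · exact absurd h1.1 hs.1.ne'
  · exact h1.1.symm
  · linarith [hs.2, hs'.2, h1.2]

/-- Two lifts `x` and `y` of a line that are never at vertices simultaneously determine the line:
the points `x n`, `y n` and the oriented edge `w n` determine their successors. As there are
finitely many such triples, this bounds the period of the line. -/
lemma IsGraph.word_periodic_of_lifts [T2Space X] (hA : A.IsGraph) (hw : A.IsPath w) {g : X → X}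
    (hgi : IsLocallyInjective g) {x y : ℝ → X} (hx : Continuous x)
    (hy : Continuous y) (hix : IsLocallyInjective x) (hiy : IsLocallyInjective y)
    (hxw : ∀ t, g (x t) = A.line w t) (hyw : ∀ t, g (y t) = A.line w t)
    (hxy : ∀ t, x t ∉ A.vert ∨ y t ∉ A.vert) {r : ℕ} (hr : 0 < r)
    (hxr : ∀ t, x (t + r) = x t) (hyr : ∀ t, y (t + r) = y t) (n : ℤ) :
    w (n + (((g ⁻¹' A.vert) ×ˢ (g ⁻¹' A.vert) ×ˢ (univ : Set (E × Bool))).ncard.factorial : ℕ)) =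
      w n := by
  have := hA.finite_edges
  have := hA.compactSpace
  have hF : (g ⁻¹' A.vert).Finite := by
    simpa using hgi.finite_preimage hA.finite_vert isCompact_univ
  have hwr : ∀ n, w (n + r) = w n := by
    obtain ⟨m, hm, hwm⟩ := exists_shift_of_line_comp_eq (A := A) (w := w) (w' := w)
      (h := OrderIso.addRight (r : ℝ)) (fun t => by
        rw [OrderIso.addRight_apply, ← hxw, ← hxw, hxr])
    have h0 := hm 0
    rw [OrderIso.addRight_apply, zero_add, zero_add] at h0
    have h0' : (r : ℤ) = m := by exact_mod_cast h0
    intro n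
    rw [h0', ← hwm]
  have hvert : ∀ n : ℤ, A.line w n ∈ A.vert := fun n => by simp [line_mem_vert_iff]
  have key := apply_add_factorial_ncard_eq (hF.prod (hF.prod finite_univ))
    (q := fun n : ℤ => (x n, y n, w n)) ?_ ?_ hr ?_ n
  · exact congrArg (fun p => p.2.2) key
  · intro n
    refine ⟨?_, ?_, mem_univ _⟩
    · change g (x n) ∈ A.vert
      rw [hxw]
      exact hvert n
    · change g (y n) ∈ A.vert
      rw [hyw]
      exact hvert n
  · intro a b hab
    simp only [Prod.mk.injEq] at hab
    obtain ⟨h1, h2, h3⟩ := hab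
    have e1 := eqOn_of_lift hw hgi hx hxw h1 h3 (⟨zero_le_one, le_rfl⟩ : (1 : ℝ) ∈ Icc 0 1)
    have e2 := eqOn_of_lift hw hgi hy hyw h2 h3 (⟨zero_le_one, le_rfl⟩ : (1 : ℝ) ∈ Icc 0 1)
    simp only at e1 e2
    push_cast
    rw [e1, e2]
    rcases hxy (a + 1) with h | h
    · rw [hA.word_add_one_eq_of_lift hw hgi hx hix hxw h1 h3 h]
    · rw [hA.word_add_one_eq_of_lift hw hgi hy hiy hyw h2 h3 h]
  · intro n
    push_cast
    rw [hxr, hyr, hwr]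

/-- A lift of a periodic line through an immersion `g` that preserves the vertices is the line of a
word whose period is bounded independently of `g`: the lift is determined by a vertex on it and the
phase of that vertex below. -/
lemma IsGraph.exists_normalForm_of_lift [T2Space X] (hA : A.IsGraph) {g : X → X}
    (hgi : IsLocallyInjective g) (hgv : MapsTo g A.vert A.vert) {x : ℝ → X} (hx : Continuous x)
    (hi : IsLocallyInjective x) {T : ℝ} (hT : 0 < T) (hper : Function.Periodic x T)
    (hxw : ∀ t, g (x t) = A.line w t) {P : ℕ} (hP : 0 < P) (hwP : ∀ n, w (n + P) = w n) :
    ∃ u, A.IsPath u ∧ IsReducedWord u ∧ (∃ θ : ℝ ≃o ℝ, ∀ t, x t = A.line u (θ t)) ∧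
      ∀ n, u (n + ((A.vert ×ˢ Ico (0 : ℤ) P).ncard.factorial : ℕ)) = u n := by
  obtain ⟨u, hu, hr, θ, hθ⟩ := hA.exists_normalForm hx hi hT hper
  refine ⟨u, hu, hr, ⟨θ, hθ⟩, ?_⟩
  have hvert : ∀ n : ℤ, x (θ.symm n) ∈ A.vert := by
    intro n
    rw [hθ, OrderIso.apply_symm_apply, line_mem_vert_iff]
    simp
  have hint : ∀ n : ℤ, ∃ k : ℤ, θ.symm n = k := by
    intro n
    have := hgv (hvert n)
    rw [hxw, line_mem_vert_iff, Int.fract_eq_zero_iff] at this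
    obtain ⟨k, hk⟩ := this
    exact ⟨k, hk.symm⟩
  choose k hk using hint
  have hPz : (0 : ℤ) < P := by exact_mod_cast hP
  obtain ⟨a, b, hab, h⟩ := exists_lt_map_eq_of_finite (hA.finite_vert.prod (finite_Ico (0 : ℤ) P))
    (g := fun i => (x (θ.symm ((i : ℕ) : ℤ)), k (i : ℕ) % P))
    fun i => ⟨hvert _, Int.emod_nonneg _ hPz.ne', Int.emod_lt_of_pos _ hPz⟩
  simp only [Prod.mk.injEq] at h
  obtain ⟨h1, h2⟩ := h
  obtain ⟨j, hj⟩ := Int.ModEq.dvd h2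
  -- the translation from the first of the two visits to the second one preserves `x`
  have hlift : (fun t => x (t + (P * j : ℤ))) = x := by
    refine (T2Space.isSeparatedMap g).eq_of_comp_eq hgi (by fun_prop) hx ?_
      (θ.symm ((a : ℕ) : ℤ)) ?_
    · ext t
      simp only [Function.comp_apply]
      rw [hxw, hxw, line_shift]
      congr 1
      ext n : 1
      rw [mul_comm]
      exact apply_add_mul_eq hwP j n
    · rw [h1, ← hj, hk, hk]
      congr 1
      push_cast
      ring
  obtain ⟨m, hm, hum⟩ := exists_shift_of_line_comp_eq (A := A) (w := u) (w' := u)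
    (h := (θ.symm.trans (OrderIso.addRight ((P * j : ℤ) : ℝ))).trans θ) (fun t => by
      rw [OrderIso.trans_apply, OrderIso.trans_apply, OrderIso.addRight_apply, ← hθ,
        congrFun hlift, hθ, OrderIso.apply_symm_apply])
  have hm' := hm ((a : ℕ) : ℤ)
  rw [OrderIso.trans_apply, OrderIso.trans_apply, OrderIso.addRight_apply, ← hj, hk] at hm'
  have e : (k ((a : ℕ) : ℤ) : ℝ) + ((k (b : ℕ) - k (a : ℕ) : ℤ) : ℝ) = θ.symm ((b : ℕ) : ℤ) := by
    rw [hk]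
    push_cast
    ring
  rw [e, OrderIso.apply_symm_apply] at hm'
  have hm'' : ((b : ℕ) : ℤ) = (a : ℕ) + m := by exact_mod_cast hm'
  obtain ⟨c, hc⟩ := Nat.exists_eq_add_of_lt (Fin.lt_def.1 hab)
  have hmc : m = ((c + 1 : ℕ) : ℤ) := by
    rw [hc] at hm''
    push_cast at hm'' ⊢
    linarith
  refine apply_add_factorial_eq (m := c + 1) (Nat.succ_pos c) (by omega) fun n => ?_
  rw [← hmc]
  exact (hum n).symm

end ArcSystem

/-! ### Loops from periodic lines -/

section Loops

variable {X : Type*} [TopologicalSpace X]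

/-- The loop given by a path of period one. -/
noncomputable def loopOfPeriodic (x : ℝ → X) (hx : Continuous x) (hp : Function.Periodic x 1) :
    C(UnitAddCircle, X) :=
  ⟨hp.lift, hx.quotient_lift _⟩

lemma loopOfPeriodic_coe {x : ℝ → X} (hx : Continuous x) (hp : Function.Periodic x 1) (s : ℝ) :
    loopOfPeriodic x hx hp (s : UnitAddCircle) = x s :=
  hp.lift_coe s

/-- Two reparametrizations of a periodic path, by maps of the line of the same degree, give
homotopic loops: interpolate linearly. -/
lemma homotopic_of_reparametrization {x : ℝ → X} (hx : Continuous x) (hp : Function.Periodic x 1)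
    {α β : ℝ → ℝ} (hα : Continuous α) (hβ : Continuous β) {k : ℤ} (hαk : ∀ t, α (t + 1) = α t + k)
    (hβk : ∀ t, β (t + 1) = β t + k) {σ τ : C(UnitAddCircle, X)}
    (hσ : ∀ s : ℝ, σ (s : UnitAddCircle) = x (α s))
    (hτ : ∀ s : ℝ, τ (s : UnitAddCircle) = x (β s)) : σ.Homotopic τ := by
  let G : unitInterval → ℝ → X := fun u s => x ((1 - u) * α s + u * β s)
  have hG : ∀ u, Function.Periodic (G u) 1 := by
    intro u s
    have : (1 - (u : ℝ)) * α (s + 1) + u * β (s + 1) =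
        ((1 - (u : ℝ)) * α s + u * β s) + k * 1 := by
      rw [hαk, hβk]
      ring
    simp only [G]
    rw [this, hp.int_mul k]
  let H : unitInterval × UnitAddCircle → X := fun p => (hG p.1).lift p.2
  have hH : Continuous H := by
    have hq : IsOpenQuotientMap (Prod.map id (fun s : ℝ => (s : UnitAddCircle)) :
        unitInterval × ℝ → unitInterval × UnitAddCircle) :=
      IsOpenQuotientMap.id.prodMap QuotientAddGroup.isOpenQuotientMap_mk
    rw [hq.isQuotientMap.continuous_iff]
    have : H ∘ Prod.map id (fun s : ℝ => (s : UnitAddCircle)) = fun p => G p.1 p.2 := by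
      ext p
      exact (hG p.1).lift_coe p.2
    rw [this]
    fun_prop
  refine ⟨⟨⟨H, hH⟩, fun a => ?_, fun a => ?_⟩⟩
  · obtain ⟨s, rfl⟩ := QuotientAddGroup.mk_surjective a
    refine ((hG 0).lift_coe s).trans ?_
    simp only [G, Set.Icc.coe_zero, sub_zero, one_mul, zero_mul, add_zero]
    exact (hσ s).symm
  · obtain ⟨s, rfl⟩ := QuotientAddGroup.mk_surjective a
    refine ((hG 1).lift_coe s).trans ?_
    simp only [G, Set.Icc.coe_one, sub_self, one_mul, zero_mul, zero_add]
    exact (hτ s).symm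

end Loops

/-! ### Periodic lines mapped to themselves by an iterate -/

/-- A periodic word has a minimal period, which divides every period. -/
lemma exists_minimal_period {α : Type*} {u : ℤ → α} {P : ℕ} (hP : 0 < P)
    (h : ∀ n, u (n + P) = u n) : ∃ m : ℕ, 0 < m ∧ (∀ n, u (n + m) = u n) ∧
      ∀ k : ℤ, (∀ n, u (n + k) = u n) → (m : ℤ) ∣ k := by
  classical
  have hex : ∃ m : ℕ, 0 < m ∧ ∀ n, u (n + m) = u n := ⟨P, hP, h⟩
  obtain ⟨hm, hper⟩ := Nat.find_spec hex
  set m := Nat.find hex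
  have hmz : (0 : ℤ) < m := by exact_mod_cast hm
  refine ⟨m, hm, hper, fun k hk => ?_⟩
  have h0 := Int.emod_nonneg k hmz.ne'
  have hlt := Int.emod_lt_of_pos k hmz
  obtain ⟨r, hr⟩ := Int.eq_ofNat_of_zero_le h0
  have hrper : ∀ n, u (n + r) = u n := by
    intro n
    rw [← hk n, ← apply_add_mul_eq hper (k / m) (n + r), ← hr]
    congr 1
    linarith [Int.emod_add_mul_ediv k m]
  have hr0 : r = 0 := by
    by_contra hne
    refine Nat.find_min hex (m := r) ?_ ⟨Nat.pos_of_ne_zero hne, hrper⟩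
    change r < m
    rw [hr] at hlt
    exact_mod_cast hlt
  rw [hr0] at hr
  exact Int.dvd_of_emod_eq_zero hr

namespace ArcSystem

variable {E X : Type*} [TopologicalSpace X] {A : ArcSystem E X}

/-- If an iterate of `f` maps a closed reduced line to itself with degree `d ≥ 2`, then `f` has an
invariant loop of degree `d`. -/
lemma IsGraph.hasInvariantLoop [T2Space X] (hA : A.IsGraph) (f : C(X, X)) {u : ℤ → E × Bool}
    (hu : A.IsPath u) (hr : IsReducedWord u) {m : ℕ} (hm : 0 < m) (hper : ∀ n, u (n + m) = u n)
    {p : ℕ} (hp : 0 < p) {θ : ℝ ≃o ℝ} (hθ : ∀ t, f^[p] (A.line u t) = A.line u (θ t)) {d : ℕ}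
    (hd : 1 ≤ d) (hdeg : ∀ t, θ (t + m) = θ t + m * d) : HasInvariantLoop f d := by
  have hm' : (m : ℝ) ≠ 0 := by positivity
  have hline : ∀ (k : ℤ) (t : ℝ), A.line u (t + m * k) = A.line u t := by
    intro k t
    have := A.line_shift (w := u) (k * m) t
    push_cast at this
    rw [mul_comm, this]
    congr 1
    ext n : 1
    exact apply_add_mul_eq hper k n
  let x : ℝ → X := fun s => A.line u (m * s)
  have hx : Continuous x := (continuous_line hu).comp (by fun_prop)
  have hx1 : Function.Periodic x 1 := by
    intro s
    have := hline 1 (m * s)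
    simp only [x]
    rw [← this]
    congr 1
    push_cast
    ring
  refine ⟨hd, p, hp, loopOfPeriodic x hx hx1, ?_, ?_⟩
  · exact hA.not_nullhomotopic hu hr hm _ fun s => loopOfPeriodic_coe hx hx1 s
  · refine homotopic_of_reparametrization hx hx1 (α := fun s => θ (m * s) / m)
      (β := fun s => d * s) ((θ.continuous.comp (by fun_prop)).div_const _) (by fun_prop)
      (k := d) ?_ ?_ ?_ ?_
    · intro t
      rw [mul_add, mul_one, hdeg, add_div, mul_div_cancel_left₀ _ hm']
      rfl
    · intro t
      push_cast
      ring
    · intro s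
      change f^[p] (loopOfPeriodic x hx hx1 (s : UnitAddCircle)) = A.line u (m * (θ (m * s) / m))
      rw [loopOfPeriodic_coe, mul_div_cancel₀ _ hm']
      exact hθ _
    · intro s
      change loopOfPeriodic x hx hx1 (d • (s : UnitAddCircle)) = _
      rw [← AddCircle.coe_nsmul, loopOfPeriodic_coe, nsmul_eq_mul]

/-- If `f^p` acts on a line through `θ`, then its powers act through homeomorphisms `Θ` of the
line, which have degree one if `θ` does. -/
lemma exists_iterate_line {f : X → X} {u : ℤ → E × Bool} {p : ℕ} {θ : ℝ ≃o ℝ}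
    (hθ : ∀ t, f^[p] (A.line u t) = A.line u (θ t)) {m : ℝ} (n : ℕ) :
    ∃ Θ : ℝ ≃o ℝ, (∀ t, f^[p * n] (A.line u t) = A.line u (Θ t)) ∧
      ((∀ t, θ (t + m) = θ t + m) → ∀ t, Θ (t + m) = Θ t + m) := by
  induction n with
  | zero => exact ⟨OrderIso.refl ℝ, fun t => rfl, fun _ t => rfl⟩
  | succ n ih =>
    obtain ⟨Θ, hΘ, hm⟩ := ih
    refine ⟨Θ.trans θ, fun t => ?_, fun h t => ?_⟩
    · rw [Nat.mul_succ, add_comm, Function.iterate_add_apply, hΘ, hθ]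
      rfl
    · simp only [OrderIso.trans_apply]
      rw [hm h, h]

/-- Suppose that `f^p` maps the closed line `line u` to itself with degree one, and `line v` to
itself. If an iterate of `f` identifies reparametrizations `x` and `y` of these two lines, then
`x = y`: both closed lines have the same image under a high power of `f^p`, so they agree up to
reparametrization, and the powers of `f^p` are injective on a closed line of degree one. -/
lemma eq_of_degree_one {f : X → X} {u v : ℤ → E × Bool} {p : ℕ} (hp : 0 < p) {θ η : ℝ ≃o ℝ}
    (hθ : ∀ t, f^[p] (A.line u t) = A.line u (θ t))
    (hη : ∀ t, f^[p] (A.line v t) = A.line v (η t)) {m : ℕ} (hper : ∀ n, u (n + m) = u n)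
    (hmin : ∀ k : ℤ, (∀ n, u (n + k) = u n) → (m : ℤ) ∣ k)
    (hdeg : ∀ t, θ (t + m) = θ t + m) {x y : ℝ → X} {α β : ℝ ≃o ℝ}
    (hx : ∀ t, x t = A.line u (α t)) (hy : ∀ t, y t = A.line v (β t)) {M : ℕ}
    (hM : ∀ t, f^[M] (x t) = f^[M] (y t)) (t : ℝ) : x t = y t := by
  obtain ⟨Θ, hΘ, hΘm⟩ := exists_iterate_line hθ (m := m) M
  obtain ⟨H, hH, -⟩ := exists_iterate_line hη (m := 0) M
  replace hΘm := hΘm hdeg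
  have hq : ∀ t, f^[p * M] (x t) = f^[p * M] (y t) := by
    intro t
    obtain ⟨c, hc⟩ := Nat.exists_eq_add_of_le' (Nat.le_mul_of_pos_left M hp)
    rw [hc, Function.iterate_add_apply, Function.iterate_add_apply, hM]
  -- `line v` is a reparametrization of `line u`, by `ψ`
  let ψ : ℝ ≃o ℝ := ((H.symm.trans β.symm).trans α).trans Θ
  have hψ : ∀ s, A.line v s = A.line u (ψ s) := by
    intro s
    have := hq (β.symm (H.symm s))
    rw [hx, hy, hΘ, hH, OrderIso.apply_symm_apply, OrderIso.apply_symm_apply] at this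
    exact this.symm
  obtain ⟨k, hk, huk⟩ := exists_shift_of_line_comp_eq (A := A) (w := u) (w' := u)
    (h := ((((Θ.symm.trans α.symm).trans β).trans ψ).trans Θ)) (fun s => by
      have := hq (α.symm (Θ.symm s))
      rw [hx, hy, hψ, hΘ, hΘ, OrderIso.apply_symm_apply, OrderIso.apply_symm_apply] at this
      exact this.symm)
  obtain ⟨a, rfl⟩ := hmin k fun n => (huk n).symm
  have hΘa : ∀ t, Θ (t + a * m) = Θ t + a * m := by
    have : Function.Periodic (fun t => Θ t - t) m := by
      intro t
      simp only [hΘm]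
      ring
    intro t
    have h2 : Θ (t + a * m) - (t + a * m) = Θ t - t := this.int_mul a t
    linarith
  have hk' := hk (Θ (α t))
  simp only [OrderIso.trans_apply, OrderIso.symm_apply_apply] at hk'
  have hkt : ψ (β t) = α t + a * m := by
    refine Θ.injective ?_
    rw [hk', hΘa]
    push_cast
    ring
  rw [hx, hy, hψ, hkt]
  have := A.line_shift (w := u) (a * m) (α t)
  push_cast at this
  rw [this]
  congr 1
  ext n : 1
  exact (apply_add_mul_eq hper a n).symm

/-- Two stages `x` and `f^p ∘ x` of a tower of lines that are given by the same periodic word, and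
similarly for `y`, yield an invariant loop of degree at least two, if `x` and `y` are distinct
but identified by an iterate of `f`. -/
lemma IsGraph.exists_hasInvariantLoop [T2Space X] (hA : A.IsGraph) (f : C(X, X))
    {u v : ℤ → E × Bool} (hu : A.IsPath u) (hr : IsReducedWord u) {P : ℕ} (hP : 0 < P)
    (huP : ∀ n, u (n + P) = u n) {p : ℕ} (hp : 0 < p) {x y : ℝ → X} {α α' β β' : ℝ ≃o ℝ}
    (hx : ∀ t, x t = A.line u (α t)) (hx' : ∀ t, f^[p] (x t) = A.line u (α' t))
    (hy : ∀ t, y t = A.line v (β t)) (hy' : ∀ t, f^[p] (y t) = A.line v (β' t)) {M : ℕ}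
    (hM : ∀ t, f^[M] (x t) = f^[M] (y t)) (hne : x 0 ≠ y 0) :
    ∃ d : ℕ, 2 ≤ d ∧ HasInvariantLoop f d := by
  obtain ⟨θ, hθ⟩ : ∃ θ : ℝ ≃o ℝ, ∀ t, f^[p] (A.line u t) = A.line u (θ t) := by
    refine ⟨α.symm.trans α', fun t => ?_⟩
    have := hx' (α.symm t)
    rwa [hx, OrderIso.apply_symm_apply] at this
  obtain ⟨η, hη⟩ : ∃ η : ℝ ≃o ℝ, ∀ t, f^[p] (A.line v t) = A.line v (η t) := by
    refine ⟨β.symm.trans β', fun t => ?_⟩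
    have := hy' (β.symm t)
    rwa [hy, OrderIso.apply_symm_apply] at this
  obtain ⟨m, hm, hper, hmin⟩ := exists_minimal_period hP huP
  have hline : ∀ t, A.line u (t + m) = A.line u t := by
    intro t
    have := A.line_shift (w := u) m t
    push_cast at this
    rw [this]
    congr 1
    ext n : 1
    exact hper n
  -- `θ` conjugates the translation by the minimal period to a translation by a period
  obtain ⟨k, hk, huk⟩ := exists_shift_of_line_comp_eq (A := A) (w := u) (w' := u)
    (h := (θ.symm.trans (OrderIso.addRight (m : ℝ))).trans θ) (fun t => by
      rw [OrderIso.trans_apply, OrderIso.trans_apply, OrderIso.addRight_apply, ← hθ, hline, hθ,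
        OrderIso.apply_symm_apply])
  have hdeg : ∀ t, θ (t + m) = θ t + k := by
    intro t
    have := hk (θ t)
    rwa [OrderIso.trans_apply, OrderIso.trans_apply, OrderIso.symm_apply_apply,
      OrderIso.addRight_apply] at this
  have hm0 : (0 : ℝ) < m := by exact_mod_cast hm
  have hk0 : 0 < k := by
    have h1 : θ 0 < θ (0 + m) := θ.strictMono (by linarith)
    rw [hdeg] at h1
    have h2 : (0 : ℝ) < k := by linarith
    exact_mod_cast h2
  obtain ⟨d, rfl⟩ := hmin k fun n => (huk n).symm
  have hd0 : 0 < d := pos_of_mul_pos_right hk0 (by positivity)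
  obtain ⟨d, rfl⟩ := Int.eq_ofNat_of_zero_le hd0.le
  have hd1 : 1 ≤ d := by exact_mod_cast hd0
  refine ⟨d, ?_, hA.hasInvariantLoop f hu hr hm hper hp hθ hd1 fun t => ?_⟩
  · by_contra hlt
    have hd : d = 1 := by omega
    subst hd
    refine hne (eq_of_degree_one hp hθ hη hper hmin (fun t => ?_) hx hy hM 0)
    rw [hdeg]
    push_cast
    ring
  · rw [hdeg]
    push_cast
    ring

end ArcSystem

/-! ### The iterated pullbacks -/

section Pullback

variable {X : Type*} [TopologicalSpace X] {f : C(X, X)}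

/-- If the core of `Γ_{i+1} \ Γ_i` is nonempty, then it contains a periodic line whose two
coordinates are immersed. -/
lemma exists_lines_of_nonempty_pullbackCore (hf : IsLocallyInjective f) {i : ℕ}
    (h : (pullbackCore f (i + 1)).Nonempty) : ∃ x y : ℝ → X, Continuous x ∧ Continuous y ∧
      IsLocallyInjective x ∧ IsLocallyInjective y ∧
      (∃ T : ℝ, 0 < T ∧ Function.Periodic x T ∧ Function.Periodic y T) ∧
      ∀ t, f^[i + 1] (x t) = f^[i + 1] (y t) ∧ f^[i] (x t) ≠ f^[i] (y t) := by
  obtain ⟨p, K, ⟨hKs, hK⟩, hp⟩ := h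
  obtain ⟨z, hz, hi, ⟨T, hT, hper⟩, hzK⟩ := hK.exists_periodic_line ⟨p, hp⟩
  have hpb : ∀ t, f^[i + 1] (z t).1 = f^[i + 1] (z t).2 ∧ f^[i] (z t).1 ≠ f^[i] (z t).2 :=
    fun t => hKs (hzK t)
  have hfi := hf.iterate f.continuous (i + 1)
  -- one coordinate determines the other one locally, as `f^(i+1)` is locally injective
  have haux : ∀ a b : ℝ → X, Continuous b → (∀ t, f^[i + 1] (a t) = f^[i + 1] (b t)) →
      (∀ s t, a s = a t → b s = b t → z s = z t) → IsLocallyInjective a := by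
    intro a b hb hab habz t
    obtain ⟨U, hU, htU, hUi⟩ := hi t
    obtain ⟨W, hW, htW, hWi⟩ := hfi (b t)
    refine ⟨U ∩ b ⁻¹' W, hU.inter (hW.preimage hb), ⟨htU, htW⟩, ?_⟩
    intro s hs s' hs' h
    refine hUi hs.1 hs'.1 (habz s s' h (hWi hs.2 hs'.2 ?_))
    rw [← hab, ← hab, h]
  refine ⟨fun t => (z t).1, fun t => (z t).2, by fun_prop, by fun_prop, ?_, ?_,
    ⟨T, hT, fun t => ?_, fun t => ?_⟩, hpb⟩
  · exact haux _ (fun t => (z t).2) (by fun_prop) (fun t => (hpb t).1) fun s t => Prod.ext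
  · exact haux _ (fun t => (z t).1) (by fun_prop) (fun t => (hpb t).1.symm)
      fun s t h2 h1 => Prod.ext h1 h2
  · exact congrArg Prod.fst (hper t)
  · exact congrArg Prod.snd (hper t)

/-- The sets `Γ_{i+1} \ Γ_i` are pairwise disjoint, so only finitely many of them contain one of
the finitely many pairs of points of `V`. -/
lemma exists_forall_iterate_eq_of_finite {Y : Type*} (f : Y → Y) {V : Set Y} (hV : V.Finite) :
    ∃ N, ∀ i ≥ N, ∀ v ∈ V, ∀ w ∈ V, f^[i + 1] v = f^[i + 1] w → f^[i] v = f^[i] w := by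
  have h : ∀ p ∈ V ×ˢ V, ∀ᶠ i in atTop, f^[i + 1] p.1 = f^[i + 1] p.2 → f^[i] p.1 = f^[i] p.2 := by
    intro p _
    by_cases hp : ∃ j, f^[j] p.1 = f^[j] p.2
    · obtain ⟨j, hj⟩ := hp
      filter_upwards [eventually_ge_atTop j] with i hi _
      obtain ⟨c, rfl⟩ := Nat.exists_eq_add_of_le' hi
      rw [Function.iterate_add_apply, Function.iterate_add_apply, hj]
    · exact Eventually.of_forall fun i hi => (hp ⟨_, hi⟩).elim
  rw [← eventually_all_finite (hV.prod hV)] at h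
  obtain ⟨N, hN⟩ := eventually_atTop.1 h
  exact ⟨N, fun i hi v hv w hw => hN i hi (v, w) ⟨hv, hw⟩⟩

/-- The words of a given period form a finite set. -/
lemma finite_setOf_periodic_word {D : Type*} [Finite D] {P : ℕ} (hP : 0 < P) :
    {u : ℤ → D | ∀ n, u (n + P) = u n}.Finite := by
  refine Finite.of_finite_image (f := fun u (i : Fin P) => u ((i : ℕ) : ℤ)) (toFinite _) ?_
  intro u hu v hv h
  have hPz : (0 : ℤ) < P := by exact_mod_cast hP
  ext n : 1
  have h0 := Int.emod_nonneg n hPz.ne'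
  have hlt := Int.emod_lt_of_pos n hPz
  obtain ⟨r, hr⟩ := Int.eq_ofNat_of_zero_le h0
  have e : n = r + (n / P) * P := by
    rw [← hr, mul_comm]
    exact (Int.emod_add_mul_ediv n P).symm
  rw [e, apply_add_mul_eq hu, apply_add_mul_eq hv]
  rw [hr] at hlt
  exact congrFun h ⟨r, by exact_mod_cast hlt⟩

end Pullback

/-- The conclusion for an immersion of a finite graph that preserves the vertices. A pair of
lines in the core of `Γ_{N+k+1} \ Γ_{N+k}` gives a tower of `k + 1` pairs of lines, by applying
the powers of `f`; the pairs are described by words from a set of `k` elements, so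
that two of them coincide. -/
lemma ArcSystem.IsGraph.exists_hasInvariantLoop_of_pullbackCore {E X : Type*} [TopologicalSpace X]
    [T2Space X] {A : ArcSystem E X} (hA : A.IsGraph) (f : C(X, X)) (hf : IsLocallyInjective f)
    (hv : MapsTo f A.vert A.vert) (hne : ∀ i : ℕ, 1 ≤ i → (pullbackCore f i).Nonempty) :
    ∃ d : ℕ, 2 ≤ d ∧ HasInvariantLoop f d := by
  have := hA.finite_edges
  have := hA.compactSpace
  obtain ⟨N, hN⟩ := exists_forall_iterate_eq_of_finite f hA.finite_vert
  -- bounds for the period below and for the periods of the lifts, uniform in the height `k`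
  set S := (f^[N + 1] ⁻¹' A.vert) ×ˢ (f^[N + 1] ⁻¹' A.vert) ×ˢ (univ : Set (E × Bool))
  set P₀ := S.ncard.factorial
  set P := (A.vert ×ˢ Ico (0 : ℤ) P₀).ncard.factorial
  have hPpos : 0 < P := Nat.factorial_pos _
  have hW := (finite_setOf_periodic_word (D := E × Bool) hPpos).prod
    (finite_setOf_periodic_word (D := E × Bool) hPpos)
  set W := {u : ℤ → E × Bool | ∀ n, u (n + P) = u n} ×ˢ
    {u : ℤ → E × Bool | ∀ n, u (n + P) = u n}
  set k := W.ncard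
  obtain ⟨x', y', hx'c, hy'c, hx'i, hy'i, ⟨T, hT, hx'T, hy'T⟩, hxy'⟩ :=
    exists_lines_of_nonempty_pullbackCore hf (i := N + k) (hne _ (by omega))
  have hit : ∀ n, Continuous f^[n] ∧ IsLocallyInjective f^[n] ∧ MapsTo f^[n] A.vert A.vert :=
    fun n => ⟨f.continuous.iterate n, hf.iterate f.continuous n, hv.iterate n⟩
  -- parametrize such that the common image of the two coordinates is in normal form
  obtain ⟨w, hw, hwr, θ, hθ⟩ := hA.exists_normalForm (x := fun t => f^[N + k + 1] (x' t))
    ((hit _).1.comp hx'c) ((hit _).2.1.comp hx'i hx'c) hT (fun t => by simp only [hx'T t])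
  obtain ⟨r, hr, -⟩ := exists_shift_of_line_comp_eq (A := A) (w := w) (w' := w)
    (h := (θ.symm.trans (OrderIso.addRight T)).trans θ) (fun t => by
      rw [OrderIso.trans_apply, OrderIso.trans_apply, OrderIso.addRight_apply, ← hθ, hx'T, hθ,
        OrderIso.apply_symm_apply])
  have hθT : ∀ t, θ.symm (t + r) = θ.symm t + T := by
    intro t
    rw [← hr t, OrderIso.trans_apply, OrderIso.trans_apply, OrderIso.addRight_apply,
      OrderIso.symm_apply_apply]
  have hr0 : 0 < r := by
    have h1 : θ.symm 0 < θ.symm (0 + r) := by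
      rw [hθT]
      linarith
    have h2 := θ.symm.lt_iff_lt.1 h1
    rw [zero_add] at h2
    exact_mod_cast h2
  obtain ⟨r, rfl⟩ := Int.eq_ofNat_of_zero_le hr0.le
  simp only [Int.cast_natCast] at hθT
  have hrpos : 0 < r := by exact_mod_cast hr0
  let x : ℝ → X := fun t => x' (θ.symm t)
  let y : ℝ → X := fun t => y' (θ.symm t)
  have hxc : Continuous x := hx'c.comp θ.symm.continuous
  have hyc : Continuous y := hy'c.comp θ.symm.continuous
  have hxi : IsLocallyInjective x :=
    hx'i.comp θ.symm.injective.IsLocallyInjective θ.symm.continuous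
  have hyi : IsLocallyInjective y :=
    hy'i.comp θ.symm.injective.IsLocallyInjective θ.symm.continuous
  have hxr : ∀ t, x (t + r) = x t := fun t => by simp only [x, hθT, hx'T _]
  have hyr : ∀ t, y (t + r) = y t := fun t => by simp only [y, hθT, hy'T _]
  have hxy : ∀ t, f^[N + k] (x t) ≠ f^[N + k] (y t) := fun t => (hxy' _).2
  have hxw : ∀ t, f^[N + k + 1] (x t) = A.line w t := fun t => by
    simp only [x, hθ, OrderIso.apply_symm_apply]
  have hyw : ∀ t, f^[N + k + 1] (y t) = A.line w t := fun t => by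
    rw [← hxw]
    exact (hxy' _).1.symm
  -- at height zero, no pair of vertices occurs, which bounds the period of `w`
  have hsplit : ∀ z : X, f^[N + k + 1] z = f^[N + 1] (f^[k] z) := fun z => by
    rw [← Function.iterate_add_apply, show N + k + 1 = N + 1 + k by omega]
  have hwP : ∀ n, w (n + P₀) = w n := by
    refine hA.word_periodic_of_lifts hw (hit (N + 1)).2.1 (x := fun t => f^[k] (x t))
      (y := fun t => f^[k] (y t)) ((hit k).1.comp hxc) ((hit k).1.comp hyc)
      ((hit k).2.1.comp hxi hxc) ((hit k).2.1.comp hyi hyc) (fun t => by rw [← hsplit, hxw])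
      (fun t => by rw [← hsplit, hyw]) (fun t => ?_) hrpos (fun t => by simp only [hxr])
      (fun t => by simp only [hyr])
    by_contra! hboth
    refine hxy t ?_
    rw [Function.iterate_add_apply, Function.iterate_add_apply]
    refine hN N le_rfl _ hboth.1 _ hboth.2 ?_
    rw [← hsplit, ← hsplit, hxw, hyw]
  -- the words of the lines at height `k - l`, for `l ≤ k`
  have hnf : ∀ z : ℝ → X, Continuous z → IsLocallyInjective z → (∀ t, z (t + r) = z t) →
      (∀ t, f^[N + k + 1] (z t) = A.line w t) → ∀ l : Fin (k + 1), ∃ u, A.IsPath u ∧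
        IsReducedWord u ∧ (∃ α : ℝ ≃o ℝ, ∀ t, f^[(l : ℕ)] (z t) = A.line u (α t)) ∧
        ∀ n, u (n + P) = u n := by
    intro z hzc hzi hzr hzw l
    refine hA.exists_normalForm_of_lift (g := f^[N + k + 1 - l]) (hit _).2.1 (hit _).2.2
      ((hit _).1.comp hzc) ((hit _).2.1.comp hzi hzc) (T := r) (by exact_mod_cast hrpos)
      (fun t => by simp only [Function.comp_apply, hzr]) (fun t => ?_) (Nat.factorial_pos _) hwP
    have hl := l.2
    rw [Function.comp_apply, ← Function.iterate_add_apply, Nat.sub_add_cancel (by omega), hzw]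
  choose u hu hur hux huP using hnf x hxc hxi hxr hxw
  choose v _ _ hvy hvP using hnf y hyc hyi hyr hyw
  choose α hα using hux
  choose β hβ using hvy
  obtain ⟨a, b, hab, heq⟩ := exists_lt_map_eq_of_finite hW (g := fun l => (u l, v l))
    fun l => ⟨huP l, hvP l⟩
  simp only [Prod.mk.injEq] at heq
  have hab' : (a : ℕ) < b := hab
  have hstep : ∀ z : X, f^[(b : ℕ) - a] (f^[(a : ℕ)] z) = f^[(b : ℕ)] z := fun z => by
    rw [← Function.iterate_add_apply, Nat.sub_add_cancel hab'.le]
  refine hA.exists_hasInvariantLoop f (hu a) (hur a) hPpos (huP a) (p := (b : ℕ) - a) (by omega)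
    (hα a) (fun t => ?_) (hβ a) (fun t => ?_) (M := N + k + 1) (fun t => ?_) (fun h => ?_)
    (α' := α b) (β' := β b)
  · rw [hstep, hα b, heq.1]
  · rw [hstep, hβ b, heq.2]
  · have hcomm := Function.Commute.iterate_iterate_self f (N + k + 1) a
    rw [hcomm (x t), hcomm (y t), hxw, hyw]
  · have ha := a.2
    refine hxy 0 ?_
    rw [← Nat.sub_add_cancel (show (a : ℕ) ≤ N + k by omega), Function.iterate_add_apply,
      Function.iterate_add_apply, h]

end GraphImmersion

open GraphImmersion in
theorem mainTheorem5 {Γ : Type*} [TopologicalSpace Γ] [T2Space Γ] [ConnectedSpace Γ]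
    [Topology.CWComplex (Set.univ : Set Γ)]
    (hΓ : GraphImmersion.IsCore (Set.univ : Set Γ))
    (f : C(Γ, Γ)) (hf : IsLocallyInjective f)
    (hv : (∀ v, 3 ≤ GraphImmersion.valence (Set.univ : Set Γ) v) ∨
      Set.MapsTo f (GraphImmersion.vertexSet (Set.univ : Set Γ))
        (GraphImmersion.vertexSet (Set.univ : Set Γ)))
    (hne : ∀ i : ℕ, 1 ≤ i → (GraphImmersion.pullbackCore f i).Nonempty) :
    ∃ d : ℕ, 2 ≤ d ∧ GraphImmersion.HasInvariantLoop f d := by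
  have hvert : MapsTo f (vertexSet (univ : Set Γ)) (vertexSet (univ : Set Γ)) :=
    hv.elim (mapsTo_vertexSet_of_three_le_valence hΓ.toIsFiniteGraph f.continuous hf) id
  exact hΓ.toIsFiniteGraph.isGraph.exists_hasInvariantLoop_of_pullbackCore f hf hvert hne
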